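/- **Setting.** Let $(\Omega,d,\mu)$ be a connected metric space with a finite non-atomic Borel measure $\mu$ that is concentrated on a separable set. For Borel sets $A\subseteq G\subseteq\Omega$ let $$P(A;G)=\liminf_{h\to0^+}\frac{\mu(\{x\in G:d(x,A)<h\})-\mu(A)}{h},\qquad I_G(s)=\inf\{P(A;G):A\subseteq G\text{ Borel},\ \mu(A)=s\},$$ so that $I_\Omega$ is the isoperimetric profile of $\Omega$. For a Lipschitz function $g:\Omega\to\mathbb R$ put $|\nabla g|(x)=\limsup_{y\to x}|g(x)-g(y)|/d(x,y)$. Assume that $I_\Omega$ is finite, continuous, concave on $[0,\mu(\Omega)]$, symmetric about $\mu(\Omega)/2$ and zero at $0$, and that for every Lipschitz $g$ and every $c\in\mathbb R$ one has $|\nabla g|=0$ $\mu$-a.e. on $\{g=c\}$. Assume also that $\Omega$ has the uniform relative isoperimetric property: there are $C>0$, $\delta>0$ such that for every open ball $B$ with $\mu(B)=\alpha$, $0<\alpha<\delta$, $$I_B(s)\ge C\min\bigl(I_\Omega(s),I_\Omega(\alpha-s)\bigr),\qquad 0<s<\alpha.$$ Let $X$ be a rearrangement-invariant Banach function space on $(\Omega,\mu)$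 with the Fatou property, $\bar X$ its representation space on $(0,\mu(\Omega))$ (that is, $\|f\|_X=\|f^*\|_{\bar X}$, with $f^*$ the decreasing rearrangement), $\bar X'$ the associate space of $\bar X$, and $\varphi_X(t)=\|\chi_A\|_X$, $\mu(A)=t$, the fundamental function. Let $S_X=\{g:\Omega\to\mathbb R\ \text{Lipschitz}:\ \||\nabla g|\|_X<\infty\}$ and, for $f\in X+S_X$, $$K(t,f;X,S_X)=\inf\{\|f-g\|_X+t\,\||\nabla g|\|_X:\ g\in S_X\}.$$ **Theorem.** Suppose that $\bigl\|1/I_\Omega\bigr\|_{\bar X'}<\infty$. If $f\in X+S_X$ satisfies $$\int_0^{\mu(\Omega)}\frac{K\bigl(\varphi_X(t)\,\|\chi_{(0,t)}/I_\Omega\|_{\bar X'},\,f;\,X,S_X\bigr)}{\varphi_X(t)}\,\frac{dt}{t}<\infty,$$ then $f$ is essentially bounded (there is $M$ with $|f|\le M$ $\mu$-a.e.) and essentially continuous ($f$ coincides $\mu$-a.e. with a continuous function on $\Omega$). -/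

import Mathlib

open MeasureTheory Set Filter Topology
open scoped ENNReal NNReal

noncomputable section

namespace MetricMorrey

/-! ### Rearrangement-invariant function norms -/

section Rearrangement

variable {α β : Type*} [MeasurableSpace α] [MeasurableSpace β]

/-- The distribution function `μ_f(t) = μ {f > t}`. -/
def distribution (μ : Measure α) (f : α → ℝ≥0∞) (t : ℝ≥0∞) : ℝ≥0∞ := μ {x | t < f x}

/-- The decreasing rearrangement `f*(s) = inf {t ≥ 0 : μ_f(t) ≤ s}`. -/
def rearrangement (μ : Measure α) (f : α → ℝ≥0∞) (s : ℝ) : ℝ≥0∞ :=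
  sInf {t | distribution μ f t ≤ ENNReal.ofReal s}

/-- `f` on `(α, μ)` and `g` on `(β, ν)` have the same distribution function. -/
def Equimeasurable (μ : Measure α) (f : α → ℝ≥0∞) (ν : Measure β) (g : β → ℝ≥0∞) : Prop :=
  ∀ t, distribution μ f t = distribution ν g t

/-- `ρ` is a rearrangement-invariant Banach function norm with the Fatou property on `(α, μ)`,
prescribed on the (a.e. classes of) nonnegative measurable functions; the corresponding
space is `X = {f : ρ |f| < ∞}` with `‖f‖_X = ρ |f|`. -/
structure IsRINorm (μ : Measure α) (ρ : (α → ℝ≥0∞) → ℝ≥0∞) : Prop where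
  eq_zero_iff : ∀ f, AEMeasurable f μ → (ρ f = 0 ↔ f =ᵐ[μ] 0)
  const_mul : ∀ (c : ℝ≥0) f, AEMeasurable f μ → ρ (fun x => (c : ℝ≥0∞) * f x) = c * ρ f
  add_le : ∀ f g, AEMeasurable f μ → AEMeasurable g μ → ρ (fun x => f x + g x) ≤ ρ f + ρ g
  mono : ∀ f g, AEMeasurable f μ → AEMeasurable g μ → f ≤ᵐ[μ] g → ρ f ≤ ρ g
  fatou : ∀ f : ℕ → α → ℝ≥0∞, (∀ n, AEMeasurable (f n) μ) → Monotone f →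
    ρ (fun x => ⨆ n, f n x) = ⨆ n, ρ (f n)
  indicator_lt_top : ∀ E, MeasurableSet E → μ E < ∞ → ρ (E.indicator 1) < ∞
  setLIntegral_le : ∀ E, MeasurableSet E → μ E < ∞ →
    ∃ C : ℝ≥0, ∀ f, AEMeasurable f μ → ∫⁻ x in E, f x ∂μ ≤ C * ρ f
  rearrangement_invariant : ∀ f g, AEMeasurable f μ → AEMeasurable g μ →
    Equimeasurable μ f μ g → ρ f = ρ g

/-- The associate norm `ρ'(g) = sup {∫ h g dν : ρ(h) ≤ 1}`. -/
def associateNorm (ν : Measure β) (ρ : (β → ℝ≥0∞) → ℝ≥0∞) (g : β → ℝ≥0∞) : ℝ≥0∞ :=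
  ⨆ (h : β → ℝ≥0∞) (_ : AEMeasurable h ν) (_ : ρ h ≤ 1), ∫⁻ y, h y * g y ∂ν

/-- Lebesgue measure on the interval `(0, μ(α))`. -/
def intervalMeasure (μ : Measure α) : Measure ℝ :=
  (volume : Measure ℝ).restrict (Ioo 0 (μ univ).toReal)

/-- The norm of the representation space `X̄` on `(0, μ(α))`: the norm of `h` is the common
value of `ρ f` over all `f` on `α` that are equimeasurable with `h`. Such an `f` exists for every
measurable `h` when `μ` is finite and non-atomic. -/
def representationNorm (μ : Measure α) (ρ : (α → ℝ≥0∞) → ℝ≥0∞) (h : ℝ → ℝ≥0∞) : ℝ≥0∞ :=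
  ⨅ (f : α → ℝ≥0∞) (_ : AEMeasurable f μ) (_ : Equimeasurable μ f (intervalMeasure μ) h), ρ f

theorem lt_rearrangement_iff (μ : Measure α) (f : α → ℝ≥0∞) (s : ℝ) (t : ℝ≥0∞) :
    t < rearrangement μ f s ↔ ENNReal.ofReal s < distribution μ f t := by
  constructor
  · intro h
    by_contra hc
    exact absurd (sInf_le (not_lt.1 hc) : rearrangement μ f s ≤ t) (not_le.2 h)
  · intro h
    have ht : t < ∞ := by
      by_contra hc
      have : t = ∞ := by simpa using hc
      simp [distribution, this] at h
    obtain ⟨u, hu, hut, hul⟩ := exists_seq_strictAnti_tendsto' ht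
    have hset : {x | t < f x} = ⋃ n, {x | u n < f x} := by
      ext x
      simp only [mem_ofPred_eq, mem_iUnion]
      constructor
      · intro hx
        exact (hul.eventually_lt_const hx).exists
      · rintro ⟨n, hn⟩
        exact (hut n).1.trans hn
    have hmono : Monotone fun n => {x | u n < f x} := fun m n hmn x hx =>
      (hu.antitone hmn).trans_lt hx
    have hlim := tendsto_measure_iUnion_atTop (μ := μ) hmono
    rw [← hset] at hlim
    obtain ⟨n, hn⟩ := (hlim.eventually_const_lt h).exists
    refine (hut n).1.trans_le (le_sInf fun v hv => ?_)
    by_contra hc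
    have : distribution μ f (u n) ≤ distribution μ f v :=
      measure_mono fun x hx => (not_le.1 hc).trans hx
    exact absurd (this.trans hv) (not_le.2 hn)

theorem equimeasurable_rearrangement (μ : Measure α) [IsFiniteMeasure μ] (f : α → ℝ≥0∞) :
    Equimeasurable μ f (intervalMeasure μ) (rearrangement μ f) := by
  intro t
  have hfin : distribution μ f t ≠ ∞ := measure_ne_top _ _
  have hle : distribution μ f t ≤ μ univ := measure_mono (subset_univ _)
  have hset : {s | t < rearrangement μ f s} ∩ Ioo 0 (μ univ).toReal
      = Ioo 0 (distribution μ f t).toReal := by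
    ext s
    simp only [mem_inter_iff, mem_ofPred_eq, lt_rearrangement_iff, mem_Ioo]
    have hr : (distribution μ f t).toReal ≤ (μ univ).toReal :=
      ENNReal.toReal_mono (measure_ne_top _ _) hle
    constructor
    · rintro ⟨h, h0, -⟩
      exact ⟨h0, (ENNReal.ofReal_lt_iff_lt_toReal h0.le hfin).1 h⟩
    · rintro ⟨h0, h⟩
      exact ⟨(ENNReal.ofReal_lt_iff_lt_toReal h0.le hfin).2 h, h0, h.trans_le hr⟩
  change distribution μ f t =
    (volume : Measure ℝ).restrict (Ioo 0 (μ univ).toReal) {s | t < rearrangement μ f s}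
  rw [Measure.restrict_apply' measurableSet_Ioo, hset, Real.volume_Ioo, sub_zero,
    ENNReal.ofReal_toReal hfin]

/-- The defining property of the representation space: `‖f‖_X = ‖f*‖_X̄`. -/
theorem representationNorm_rearrangement (μ : Measure α) [IsFiniteMeasure μ]
    (ρ : (α → ℝ≥0∞) → ℝ≥0∞) (hρ : IsRINorm μ ρ) (f : α → ℝ≥0∞) (hf : AEMeasurable f μ) :
    representationNorm μ ρ (rearrangement μ f) = ρ f := by
  refine le_antisymm (iInf₂_le_of_le f hf (iInf_le _ (equimeasurable_rearrangement μ f))) ?_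
  refine le_iInf fun g => le_iInf fun hg => le_iInf fun h => le_of_eq ?_
  exact hρ.rearrangement_invariant f g hf hg fun t =>
    (equimeasurable_rearrangement μ f t).trans (h t).symm

/-- The fundamental function `φ_X(t) = ‖χ_A‖_X`, `μ(A) = t` (the value does not depend on the
choice of `A`). -/
def fundamentalFunction (μ : Measure α) (ρ : (α → ℝ≥0∞) → ℝ≥0∞) (t : ℝ) : ℝ≥0∞ :=
  ⨅ (A : Set α) (_ : MeasurableSet A) (_ : μ A = ENNReal.ofReal t), ρ (A.indicator 1)

end Rearrangement

/-! ### Perimeter, isoperimetric profiles, Lipschitz functions and the K-functional -/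

section Metric

variable {Ω : Type*} [MetricSpace Ω] [MeasurableSpace Ω]

/-- The perimeter (lower Minkowski content) of `A` relative to `G`,
`liminf_{h → 0+} (μ {x ∈ G : d(x, A) < h} - μ (A ∩ G)) / h`. -/
def relPerimeter (μ : Measure Ω) (G A : Set Ω) : ℝ≥0∞ :=
  liminf (fun h : ℝ => (μ (Metric.thickening h A ∩ G) - μ (A ∩ G)) / ENNReal.ofReal h) (𝓝[>] 0)

/-- The relative isoperimetric profile `I_G(s)`, the infimum of the relative perimeters
of the Borel sets `A ⊆ G` with `μ(A) = s`. -/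
def relProfile (μ : Measure Ω) (G : Set Ω) (s : ℝ) : ℝ≥0∞ :=
  ⨅ (A : Set Ω) (_ : MeasurableSet A) (_ : A ⊆ G) (_ : μ A = ENNReal.ofReal s),
    relPerimeter μ G A

/-- The isoperimetric profile `I_Ω`. -/
def profile (μ : Measure Ω) (s : ℝ) : ℝ≥0∞ := relProfile μ univ s

/-- The modulus of the gradient, `limsup_{y → x} |g(x) - g(y)| / d(x, y)`. -/
def gradModulus (g : Ω → ℝ) (x : Ω) : ℝ≥0∞ :=
  limsup (fun y => edist (g x) (g y) / edist x y) (𝓝[≠] x)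

/-- The standard assumptions on the metric measure space: the measure lives on a separable set;
the isoperimetric profile is finite, continuous, concave, symmetric about `μ(Ω)/2` and vanishes at
zero; the gradient of a Lipschitz function vanishes a.e. on each of its level sets. -/
structure StandardAssumptions (μ : Measure Ω) : Prop where
  separable : ∃ S : Set Ω, TopologicalSpace.IsSeparable S ∧ μ Sᶜ = 0
  profile_ne_top : ∀ t ∈ Icc 0 (μ univ).toReal, profile μ t ≠ ∞
  profile_continuous : ContinuousOn (fun t => (profile μ t).toReal) (Icc 0 (μ univ).toReal)
  profile_concave : ConcaveOn ℝ (Icc 0 (μ univ).toReal) (fun t => (profile μ t).toReal)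
  profile_symm : ∀ t ∈ Icc 0 (μ univ).toReal, profile μ ((μ univ).toReal - t) = profile μ t
  profile_zero : profile μ 0 = 0
  grad_level : ∀ g : Ω → ℝ, (∃ L, LipschitzWith L g) → ∀ c : ℝ,
    ∀ᵐ x ∂μ, g x = c → gradModulus g x = 0

/-- The uniform relative isoperimetric property. -/
def UniformRelativeIsoperimetric (μ : Measure Ω) : Prop :=
  ∃ C : ℝ≥0, 0 < C ∧ ∃ δ : ℝ, 0 < δ ∧ ∀ (x : Ω) (r α : ℝ), 0 < α → α < δ →
    μ (Metric.ball x r) = ENNReal.ofReal α →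
    ∀ s ∈ Ioo 0 α, C * min (profile μ s) (profile μ (α - s)) ≤ relProfile μ (Metric.ball x r) s

/-- `S_X`: the Lipschitz functions `g` with `‖|∇g|‖_X < ∞`. -/
def lipClass (ρ : (Ω → ℝ≥0∞) → ℝ≥0∞) : Set (Ω → ℝ) :=
  {g | (∃ L, LipschitzWith L g) ∧ ρ (gradModulus g) < ∞}

/-- `f ∈ X + S_X`. -/
def MemSum (μ : Measure Ω) (ρ : (Ω → ℝ≥0∞) → ℝ≥0∞) (f : Ω → ℝ) : Prop :=
  ∃ u g : Ω → ℝ, AEMeasurable u μ ∧ ρ (fun x => ‖u x‖ₑ) < ∞ ∧ g ∈ lipClass ρ ∧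
    f =ᵐ[μ] fun x => u x + g x

/-- The K-functional `K(t, f; X, S_X) = inf {‖f - g‖_X + t ‖|∇g|‖_X : g ∈ S_X}`. -/
def kFunctional (ρ : (Ω → ℝ≥0∞) → ℝ≥0∞) (t : ℝ≥0∞) (f : Ω → ℝ) : ℝ≥0∞ :=
  ⨅ g ∈ lipClass ρ, (ρ (fun x => ‖f x - g x‖ₑ) + t * ρ (gradModulus g))

/-- `‖χ_(0,t) / I_Ω‖_{X̄'}`, the norm being that of the associate of the representation space. -/
def recipProfileNorm (μ : Measure Ω) (ρ : (Ω → ℝ≥0∞) → ℝ≥0∞) (t : ℝ) : ℝ≥0∞ :=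
  associateNorm (intervalMeasure μ) (representationNorm μ ρ)
    ((Ioo 0 t).indicator fun s => (profile μ s)⁻¹)

end Metric

end MetricMorrey

end

open MetricMorrey

/-! The essential oscillation of `f` on a set `G` of measure `α` is at most a constant times `∫_0^α
kRate dt/t`, the tail of the integral assumed finite (`exists_ae_abs_sub_le`). Taking `G = Ω` gives
boundedness. Taking `G` a small ball, whose measure tends to zero because points are null, gives
vanishing oscillation at every point, hence a continuous representative (`exists_continuous_ae_eq`).

The oscillation bound telescopes over quantiles of `f` on `G` at the dyadic masses `s_k = α /
2^(k+1)`. Each jump is at most a constant times `kRate` at `s_k` (`quantile_gap_le`). Since `K` is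
nondecreasing and `φ_X` is doubling, this is controlled by the integral over `(s_k, 2 s_k)`
(`kRate_le_lintegral`), and these intervals are disjoint. Applying the upper bound to `-f` with the
same median gives the lower one.

For a single jump at mass `s`, compare `f` with a Lipschitz `g`. Outside a set of measure `s/4` the
error is of order `‖f - g‖_X / φ_X(s)`, so the jump of `f` passes to `g` between two levels whose
superlevel sets in `G` have mass between `s/4` and `5s/4`. There the relative isoperimetric
inequality bounds perimeters below by `C · I(s/4)`, while the coarea inequality
(`lintegral_relPerimeter_le`) bounds their integral over levels by that of `|∇g|` on a set of
measure at most `2s`. Rearrangement and Hölder turn the latter into `2 I(s) ‖χ_(0,s)/I‖ ‖|∇g|‖_X`,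
and `I(s) ≤ 4 I(s/4)` by concavity, so the profile cancels (`levels_gap_le`). -/

namespace MetricMorrey

/-! ### Quantiles. -/

section Quantile

variable {α : Type*} [MeasurableSpace α]

/-- Existence of upper quantiles of a measurable function on a finite measure space. -/
theorem exists_quantile (ν : Measure α) [IsFiniteMeasure ν] {f : α → ℝ} (hf : Measurable f)
    {s : ℝ≥0∞} (hs0 : 0 < s) (hs : s < ν univ) :
    ∃ c : ℝ, ν {x | c < f x} ≤ s ∧ s ≤ ν {x | c ≤ f x} := by
  have hm : ∀ c, MeasurableSet {x | c < f x} := fun c => measurableSet_lt measurable_const hf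
  have hanti : Antitone fun c : ℝ => {x | c < f x} := fun a b hab x hx => hab.trans_lt hx
  set S := {c : ℝ | ν {x | c < f x} ≤ s} with hS
  have hne : S.Nonempty := by
    have h := tendsto_measure_iInter_atTop (μ := ν) (fun c => (hm c).nullMeasurableSet) hanti
      ⟨0, measure_ne_top _ _⟩
    have h0 : ⋂ c : ℝ, {x | c < f x} = ∅ := by
      ext x
      simp only [mem_iInter, mem_ofPred_eq, mem_empty_iff_false, iff_false, not_forall]
      exact ⟨f x, lt_irrefl _⟩
    rw [h0, measure_empty] at h
    obtain ⟨c, hc⟩ := (h.eventually_lt_const hs0).exists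
    exact ⟨c, hc.le⟩
  have hbdd : BddBelow S := by
    have h := tendsto_measure_iUnion_atBot (μ := ν) hanti
    have h0 : ⋃ c : ℝ, {x | c < f x} = univ := by
      ext x
      simp only [mem_iUnion, mem_ofPred_eq, mem_univ, iff_true]
      exact exists_lt _
    rw [h0] at h
    obtain ⟨c, hc⟩ := (h.eventually_const_lt hs).exists
    refine ⟨c, fun d hd => ?_⟩
    by_contra hcd
    exact absurd ((hc.trans_le (measure_mono (hanti (not_le.1 hcd).le))).trans_le hd) (lt_irrefl _)
  -- The quantile is `sInf S`: levels decreasing to it give the first bound by continuity from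
  -- below, levels increasing to it the second by continuity from above.
  obtain ⟨u, hu, huc, hul⟩ := exists_seq_strictAnti_tendsto (sInf S)
  obtain ⟨v, hv, hvc, hvl⟩ := exists_seq_strictMono_tendsto (sInf S)
  refine ⟨sInf S, ?_, ?_⟩
  · have hset : {x | sInf S < f x} = ⋃ n, {x | u n < f x} := by
      ext x
      simp only [mem_ofPred_eq, mem_iUnion]
      exact ⟨fun hx => (hul.eventually_lt_const hx).exists, fun ⟨n, hn⟩ => (huc n).trans hn⟩
    have hlim := tendsto_measure_iUnion_atTop (μ := ν)
      (s := fun n => {x | u n < f x}) fun m n hmn => hanti (hu.antitone hmn)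
    rw [← hset] at hlim
    refine le_of_tendsto' hlim fun n => ?_
    obtain ⟨d, hd, hdu⟩ := exists_lt_of_csInf_lt hne (huc n)
    exact (measure_mono (hanti hdu.le)).trans hd
  · have hset : {x | sInf S ≤ f x} = ⋂ n, {x | v n < f x} := by
      ext x
      simp only [mem_ofPred_eq, mem_iInter]
      exact ⟨fun hx n => (hvc n).trans_le hx, fun h => le_of_tendsto' hvl fun n => (h n).le⟩
    have hlim := tendsto_measure_iInter_atTop (μ := ν)
      (s := fun n => {x | v n < f x}) (fun n => (hm _).nullMeasurableSet)
      (fun m n hmn => hanti (hv.monotone hmn)) ⟨0, measure_ne_top _ _⟩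
    rw [← hset] at hlim
    refine ge_of_tendsto' hlim fun n => ?_
    by_contra hc
    exact absurd (csInf_le hbdd (show v n ∈ S from (not_le.1 hc).le)) (not_le.2 (hvc n))

end Quantile

/-! ### Sets of prescribed measure in a non-atomic space. -/

section Sierpinski

variable {Ω : Type*} [MetricSpace Ω] [MeasurableSpace Ω] [BorelSpace Ω]

/-- A measure without point masses that is concentrated on a separable set admits a measurable
real function with null fibres. -/
theorem exists_measurable_null_fibres (μ : Measure Ω) [NullSingletonClass μ]
    (hsep : ∃ S : Set Ω, TopologicalSpace.IsSeparable S ∧ μ Sᶜ = 0) :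
    ∃ e : Ω → ℝ, Measurable e ∧ ∀ r, μ (e ⁻¹' {r}) = 0 := by
  classical
  obtain ⟨S, hS, hS0⟩ := hsep
  have hT : TopologicalSpace.IsSeparable (closure S) := hS.closure
  have : SecondCountableTopology (closure S) := hT.secondCountableTopology
  -- A second countable space injects measurably into Cantor space and then into `ℝ`, so each fibre
  -- meets `closure S` in at most one point, which is null.
  obtain ⟨φ, hφ, hφi⟩ :=
    MeasurableSpace.measurable_injection_nat_bool_of_countablySeparated (closure S)
  obtain ⟨ψ, hψ⟩ := MeasureTheory.exists_measurableEmbedding_real (ℕ → Bool)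
  refine ⟨fun x => if h : x ∈ closure S then ψ (φ ⟨x, h⟩) else 0, ?_, fun r => ?_⟩
  · exact Measurable.dite (hψ.measurable.comp hφ) measurable_const
      isClosed_closure.measurableSet
  · have h1 : ((fun x => if h : x ∈ closure S then ψ (φ ⟨x, h⟩) else 0) ⁻¹' {r} ∩
        closure S).Subsingleton := by
      rintro x ⟨hx, hxS⟩ y ⟨hy, hyS⟩
      simp only [mem_preimage, mem_singleton_iff, hxS, hyS, dif_pos] at hx hy
      have := hφi (hψ.injective (hx.trans hy.symm))
      simpa using this
    have h2 : μ (closure S)ᶜ = 0 :=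
      measure_mono_null (compl_subset_compl.2 subset_closure) hS0
    refine measure_mono_null (t := _ ∪ (closure S)ᶜ) (fun x hx => ?_)
      (measure_union_null (h1.measure_zero μ) h2)
    by_cases hxS : x ∈ closure S
    · exact Or.inl ⟨hx, hxS⟩
    · exact Or.inr hxS

/-- Sierpiński's theorem on subsets of prescribed measure. -/
theorem exists_measurable_subset_measure_eq (μ : Measure Ω) [IsFiniteMeasure μ]
    [NullSingletonClass μ]
    (hsep : ∃ S : Set Ω, TopologicalSpace.IsSeparable S ∧ μ Sᶜ = 0)
    {A : Set Ω} (hA : MeasurableSet A) {s : ℝ≥0∞} (hs : s ≤ μ A) :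
    ∃ B ⊆ A, MeasurableSet B ∧ μ B = s := by
  rcases eq_or_ne s 0 with rfl | h0
  · exact ⟨∅, empty_subset _, MeasurableSet.empty, measure_empty⟩
  rcases hs.eq_or_lt with rfl | hlt
  · exact ⟨A, Subset.rfl, hA, rfl⟩
  obtain ⟨e, he, hnull⟩ := exists_measurable_null_fibres μ hsep
  -- Because the fibre `e = c` is null, the two quantile inequalities become an equality.
  obtain ⟨c, hc1, hc2⟩ := exists_quantile (μ.restrict A) he (pos_iff_ne_zero.2 h0) (by simpa)
  have hm : MeasurableSet {x | c ≤ e x} := measurableSet_le measurable_const he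
  rw [Measure.restrict_apply (measurableSet_lt measurable_const he)] at hc1
  rw [Measure.restrict_apply hm] at hc2
  refine ⟨{x | c ≤ e x} ∩ A, inter_subset_right, hm.inter hA, le_antisymm ?_ hc2⟩
  calc μ ({x | c ≤ e x} ∩ A) ≤ μ (({x | c < e x} ∩ A) ∪ e ⁻¹' {c}) := by
        refine measure_mono fun x hx => ?_
        rcases (show c ≤ e x from hx.1).eq_or_lt with h | h
        · exact Or.inr h.symm
        · exact Or.inl ⟨h, hx.2⟩
    _ ≤ μ ({x | c < e x} ∩ A) + μ (e ⁻¹' {c}) := measure_union_le _ _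
    _ ≤ s := by rw [hnull, add_zero]; exact hc1

end Sierpinski

/-! ### From vanishing essential oscillation to a continuous representative. -/

section ContinuousRepresentative

variable {Ω : Type*} [MetricSpace Ω] [MeasurableSpace Ω]

/-- A function whose essential oscillation vanishes at every point coincides almost everywhere
with a continuous function. -/
theorem exists_continuous_ae_eq (μ : Measure Ω)
    (hsep : ∃ S : Set Ω, TopologicalSpace.IsSeparable S ∧ μ Sᶜ = 0) (f : Ω → ℝ)
    (hosc : ∀ x, ∀ ε > (0 : ℝ), ∃ r > (0 : ℝ), ∃ c : ℝ,
      ∀ᵐ y ∂μ, y ∈ Metric.ball x r → |f y - c| ≤ ε) :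
    ∃ g : Ω → ℝ, Continuous g ∧ f =ᵐ[μ] g := by
  obtain ⟨S, hS, hS0⟩ := hsep
  have hT : TopologicalSpace.IsSeparable (closure S) := hS.closure
  have : SecondCountableTopology (closure S) := hT.secondCountableTopology
  have hlin : IsLindelof (closure S) := isLindelof_iff_lindelofSpace.2 inferInstance
  have hpos : ∀ n : ℕ, (0 : ℝ) < 1 / ((n : ℝ) + 1) := fun n => by positivity
  choose r hr c hc using fun (n : ℕ) x => hosc x _ (hpos n)
  have hcov : ∀ n, ∃ t : Set Ω, t.Countable ∧ closure S ⊆ ⋃ x ∈ t, Metric.ball x (r n x) := by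
    intro n
    obtain ⟨t, ht, htc⟩ := hlin.elim_countable_subcover (fun x => Metric.ball x (r n x))
      (fun x => Metric.isOpen_ball) fun x _ => mem_iUnion.2 ⟨x, Metric.mem_ball_self (hr n x)⟩
    exact ⟨t, ht, htc⟩
  choose t ht htc using hcov
  -- By Lindelöf only countably many balls are needed, so the exceptional null sets can be discarded
  -- together; on `A` the oscillation bounds hold pointwise.
  set A : Set Ω := {y | y ∈ closure S ∧
    ∀ n, ∀ x ∈ t n, y ∈ Metric.ball x (r n x) → |f y - c n x| ≤ 1 / ((n : ℝ) + 1)} with hA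
  have hAae : ∀ᵐ y ∂μ, y ∈ A := by
    have h1 : ∀ᵐ y ∂μ, y ∈ closure S := by
      rw [ae_iff]
      exact measure_mono_null (compl_subset_compl.2 subset_closure) hS0
    have h2 : ∀ᵐ y ∂μ, ∀ n, ∀ x ∈ t n, y ∈ Metric.ball x (r n x) →
        |f y - c n x| ≤ 1 / ((n : ℝ) + 1) :=
      ae_all_iff.2 fun n => (ae_ball_iff (ht n)).2 fun x _ => hc n x
    filter_upwards [h1, h2] with y hy1 hy2 using ⟨hy1, hy2⟩
  have hclA : closure A ⊆ closure S := closure_minimal (fun y hy => hy.1) isClosed_closure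
  have hlim : ∀ x ∈ closure A, ∃ y, Tendsto f (𝓝[A] x) (𝓝 y) := by
    intro x hx
    have : (𝓝[A] x).NeBot := mem_closure_iff_nhdsWithin_neBot.1 hx
    refine CompleteSpace.complete (f := map f (𝓝[A] x)) ?_
    refine Metric.cauchy_iff.2 ⟨inferInstance, fun ε hε => ?_⟩
    obtain ⟨n, hn⟩ := exists_nat_one_div_lt (half_pos hε)
    obtain ⟨z, hz, hxz⟩ := mem_iUnion₂.1 (htc n (hclA hx))
    refine ⟨f '' (A ∩ Metric.ball z (r n z)), image_mem_map (inter_mem self_mem_nhdsWithin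
      (mem_nhdsWithin_of_mem_nhds (Metric.isOpen_ball.mem_nhds hxz))), ?_⟩
    rintro _ ⟨p, ⟨hpA, hp⟩, rfl⟩ _ ⟨q, ⟨hqA, hq⟩, rfl⟩
    have h1 := abs_le.1 (hpA.2 n z hz hp)
    have h2 := abs_le.1 (hqA.2 n z hz hq)
    rw [Real.dist_eq, abs_lt]
    constructor <;> linarith
  have hcont : ContinuousOn (extendFrom A f) (closure A) := continuousOn_extendFrom Subset.rfl hlim
  -- `A` need not be dense in `Ω`, so Tietze's theorem extends the function from `closure A`.
  obtain ⟨g, hg⟩ := ContinuousMap.exists_restrict_eq (Y := ℝ) (isClosed_closure (s := A))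
    ⟨(closure A).domRestrict (extendFrom A f), continuousOn_iff_continuous_domRestrict.1 hcont⟩
  refine ⟨g, g.continuous, ?_⟩
  filter_upwards [hAae] with x hx
  have hxc : x ∈ closure A := subset_closure hx
  obtain ⟨y, hy⟩ := hlim x hxc
  have h1 : extendFrom A f x = y := extendFrom_eq hxc hy
  have h2 : f x = y :=
    tendsto_nhds_unique (tendsto_pure_nhds f x) (hy.mono_left (pure_le_nhdsWithin hx))
  have h3 : g x = extendFrom A f x := DFunLike.congr_fun hg (⟨x, hxc⟩ : closure A)
  rw [h2, ← h1, ← h3]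

end ContinuousRepresentative

/-! ### The coarea inequality for the lower Minkowski content. -/

section Coarea

variable {Ω : Type*} [MetricSpace Ω]

/-- The limsup is a countable infimum, over radii `1/(n+1)`, of suprema over punctured balls. Each
supremum is lower semicontinuous, since its strict superlevel sets are unions of open sets indexed
by `y`. -/
theorem measurable_gradModulus [MeasurableSpace Ω] [BorelSpace Ω] {g : Ω → ℝ}
    (hg : Continuous g) : Measurable (gradModulus g) := by
  have hb : ∀ x : Ω, (𝓝[≠] x).HasBasis (fun _ : ℕ => True)
      fun n => Metric.ball x (1 / ((n : ℝ) + 1)) ∩ {x}ᶜ := fun x =>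
    nhdsWithin_hasBasis Metric.nhds_basis_ball_inv_nat_succ _
  have heq : gradModulus g = fun x => ⨅ n : ℕ,
      ⨆ y ∈ Metric.ball x (1 / ((n : ℝ) + 1)) ∩ {x}ᶜ, edist (g x) (g y) / edist x y := by
    ext x
    rw [gradModulus, (hb x).limsup_eq_iInf_iSup]
    simp only [iInf_true]
  rw [heq]
  refine Measurable.iInf fun n => measurable_of_Ioi fun c => IsOpen.measurableSet ?_
  have hset : (fun x => ⨆ y ∈ Metric.ball x (1 / ((n : ℝ) + 1)) ∩ {x}ᶜ,
      edist (g x) (g y) / edist x y) ⁻¹' Ioi c = ⋃ y, {x | dist y x < 1 / ((n : ℝ) + 1)} ∩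
        {x | y ≠ x ∧ c * edist x y < edist (g x) (g y)} := by
    ext x
    simp only [mem_preimage, mem_Ioi, lt_iSup_iff, mem_iUnion, mem_inter_iff, Metric.mem_ball,
      mem_compl_iff, mem_singleton_iff, mem_ofPred_eq, exists_prop]
    refine exists_congr fun y => ⟨?_, ?_⟩
    · rintro ⟨⟨h1, h2⟩, h3⟩
      refine ⟨h1, h2, ?_⟩
      rwa [ENNReal.lt_div_iff_mul_lt (Or.inl (by simpa [eq_comm] using h2))
        (Or.inl (edist_ne_top _ _))] at h3
    · rintro ⟨h1, h2, h3⟩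
      refine ⟨⟨h1, h2⟩, ?_⟩
      rwa [ENNReal.lt_div_iff_mul_lt (Or.inl (by simpa [eq_comm] using h2))
        (Or.inl (edist_ne_top _ _))]
  rw [hset]
  refine isOpen_iUnion fun y => ?_
  have h1 : IsOpen {x | dist y x < 1 / ((n : ℝ) + 1)} :=
    isOpen_lt (by fun_prop) continuous_const
  by_cases hc : c = ∞
  · convert isOpen_empty (X := Ω)
    ext x
    simp only [mem_inter_iff, mem_ofPred_eq, mem_empty_iff_false, iff_false, not_and]
    rintro - hne
    rw [hc, ENNReal.top_mul (by simpa [eq_comm] using hne)]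
    exact not_top_lt
  · have h2 : IsOpen {x | c * edist x y < edist (g x) (g y)} :=
      isOpen_lt ((ENNReal.continuous_const_mul hc).comp (by fun_prop)) (by fun_prop)
    exact h1.inter ((isOpen_ne_fun continuous_const continuous_id).inter h2)

theorem eventually_edist_le_of_gradModulus_lt {g : Ω → ℝ} {x : Ω} {q : ℝ≥0∞}
    (hq : gradModulus g x < q) : ∀ᶠ y in 𝓝 x, edist (g x) (g y) ≤ q * edist x y := by
  have h := eventually_lt_of_limsup_lt hq
  rw [eventually_nhdsWithin_iff] at h
  filter_upwards [h] with y hy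
  rcases eq_or_ne y x with rfl | hne
  · simp
  · have := (hy hne).le
    rwa [ENNReal.div_le_iff (by simpa [eq_comm] using hne) (edist_ne_top _ _)] at this

/-- The set of levels in `(a, b)` that are crossed when passing from `x` to its `h`-ball. -/
def crossedLevels (g : Ω → ℝ) (a b h : ℝ) (x : Ω) : Set ℝ :=
  {τ | τ ∈ Ioo a b ∧ g x ≤ τ ∧ x ∈ Metric.thickening h {y | τ < g y}}

/-- Every crossed level lies in `[g x, g x + q h)`. This serves both with the global Lipschitz
constant, for domination, and with any `q` above the local gradient, for the limit. -/
theorem volume_crossedLevels_le {g : Ω → ℝ} {a b h : ℝ} {x : Ω} {q : ℝ≥0∞}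
    (hq : ∀ y ∈ Metric.ball x h, edist (g x) (g y) ≤ q * edist x y) :
    volume (crossedLevels g a b h x) ≤ q * ENNReal.ofReal h := by
  rcases eq_or_ne q ∞ with rfl | hqt
  · rcases le_or_gt h 0 with h0 | h0
    · have : crossedLevels g a b h x = ∅ := by
        ext τ
        simp [crossedLevels, Metric.thickening_of_nonpos h0]
      simp [this]
    · rw [ENNReal.top_mul (by simpa using h0)]
      exact le_top
  have hsub : crossedLevels g a b h x ⊆ Ico (g x) (g x + q.toReal * h) := by
    rintro τ ⟨-, h1, h2⟩
    obtain ⟨y, hy, hxy⟩ := Metric.mem_thickening_iff.1 h2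
    refine ⟨h1, (show τ < g y from hy).trans_le ?_⟩
    have h3 := hq y (by rwa [Metric.mem_ball, dist_comm])
    have h4 : dist (g x) (g y) ≤ q.toReal * dist x y := by
      have := ENNReal.toReal_mono (ENNReal.mul_ne_top hqt (edist_ne_top x y)) h3
      rwa [ENNReal.toReal_mul, ← dist_edist, ← dist_edist] at this
    rw [Real.dist_eq, abs_sub_comm] at h4
    have h5 := (le_abs_self _).trans h4
    have h6 := mul_le_mul_of_nonneg_left hxy.le (ENNReal.toReal_nonneg (a := q))
    linarith
  refine (measure_mono hsub).trans ?_
  rw [Real.volume_Ico, add_sub_cancel_left, ENNReal.ofReal_mul ENNReal.toReal_nonneg,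
    ENNReal.ofReal_toReal hqt]

theorem crossedLevels_eq_empty_of_le {g : Ω → ℝ} {a b h : ℝ} {x : Ω} (hx : b ≤ g x) :
    crossedLevels g a b h x = ∅ := by
  ext τ
  simp only [crossedLevels, mem_ofPred_eq, mem_Ioo, mem_empty_iff_false, iff_false]
  rintro ⟨⟨-, h1⟩, h2, -⟩
  linarith

/-- Membership in the thickening says that `τ` is below the supremum of `g` over the `h`-ball, a
lower semicontinuous function of the centre. `EReal` accommodates unbounded `g` and empty balls. -/
theorem measurableSet_crossedLevels [MeasurableSpace Ω] [BorelSpace Ω] {g : Ω → ℝ}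
    (hg : Continuous g) (h : ℝ) (a b : ℝ) :
    MeasurableSet {p : Ω × ℝ | p.2 ∈ crossedLevels g a b h p.1} := by
  have hsup : Measurable fun x => ⨆ y ∈ Metric.ball x h, (g y : EReal) := by
    refine measurable_of_Ioi fun c => IsOpen.measurableSet ?_
    convert Metric.isOpen_thickening (δ := h) (E := {y | c < (g y : EReal)}) using 1
    ext x
    simp only [mem_preimage, mem_Ioi, lt_iSup_iff, Metric.mem_thickening_iff, Metric.mem_ball,
      mem_ofPred_eq, exists_prop, dist_comm x, and_comm]
  have hset : {p : Ω × ℝ | p.2 ∈ crossedLevels g a b h p.1} =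
      (Prod.snd ⁻¹' Ioo a b ∩ {p : Ω × ℝ | g p.1 ≤ p.2}) ∩
        {p : Ω × ℝ | (p.2 : EReal) < ⨆ y ∈ Metric.ball p.1 h, (g y : EReal)} := by
    ext ⟨x, τ⟩
    simp only [crossedLevels, mem_ofPred_eq, mem_inter_iff, mem_preimage, lt_iSup_iff,
      Metric.mem_thickening_iff, Metric.mem_ball, EReal.coe_lt_coe_iff, exists_prop,
      dist_comm x, and_assoc]
    simp only [and_comm (a := _ < g _)]
  rw [hset]
  exact ((measurable_snd measurableSet_Ioo).inter
    (measurableSet_le (hg.measurable.comp measurable_fst) measurable_snd)).inter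
    (measurableSet_lt (measurable_coe_real_ereal.comp measurable_snd) (hsup.comp measurable_fst))

theorem lintegral_measure_thickening_diff [MeasurableSpace Ω] [BorelSpace Ω] (μ : Measure Ω)
    [IsFiniteMeasure μ] {g : Ω → ℝ} (hg : Continuous g) (G : Set Ω) (a b h : ℝ) :
    Measurable (fun τ => μ.restrict G {x | τ ∈ crossedLevels g a b h x}) ∧
    Measurable (fun x => volume (crossedLevels g a b h x)) ∧
    ∫⁻ τ, μ.restrict G {x | τ ∈ crossedLevels g a b h x} =
      ∫⁻ x in G, volume (crossedLevels g a b h x) ∂μ := by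
  have hm := measurableSet_crossedLevels hg h a b
  refine ⟨measurable_measure_prodMk_right hm, measurable_measure_prodMk_left hm, ?_⟩
  exact (Measure.prod_apply_symm (μ := μ.restrict G) (ν := volume) hm).symm.trans
    (Measure.prod_apply hm)

/-- A point of `G` gained by thickening the superlevel set crosses `τ`. Restricting `h` to a
sequence only raises the liminf, and a sequence is what Fatou's lemma needs. -/
theorem relPerimeter_superlevel_le [MeasurableSpace Ω] [BorelSpace Ω] (μ : Measure Ω)
    {g : Ω → ℝ} {G : Set Ω} (hG : MeasurableSet G) {a b τ : ℝ} (hτ : τ ∈ Ioo a b) :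
    relPerimeter μ G ({x | τ < g x} ∩ G) ≤
      liminf (fun n : ℕ => μ.restrict G {x | τ ∈ crossedLevels g a b (1 / ((n : ℝ) + 1)) x} /
        ENNReal.ofReal (1 / ((n : ℝ) + 1))) atTop := by
  have hh : Tendsto (fun n : ℕ => 1 / ((n : ℝ) + 1)) atTop (𝓝[>] 0) :=
    tendsto_nhdsWithin_iff.2 ⟨tendsto_one_div_add_atTop_nhds_zero_nat,
      Eventually.of_forall fun n => by simp only [mem_Ioi]; positivity⟩
  have key : ∀ h : ℝ, (μ (Metric.thickening h ({x | τ < g x} ∩ G) ∩ G) -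
      μ (({x | τ < g x} ∩ G) ∩ G)) / ENNReal.ofReal h ≤
      μ.restrict G {x | τ ∈ crossedLevels g a b h x} / ENNReal.ofReal h := by
    intro h
    refine ENNReal.div_le_div_right (le_measure_sdiff.trans ?_) _
    rw [Measure.restrict_apply' hG]
    refine measure_mono ?_
    rintro x ⟨⟨h1, h2⟩, h3⟩
    refine ⟨⟨hτ, ?_, Metric.thickening_subset_of_subset _ inter_subset_left h1⟩, h2⟩
    by_contra hc
    exact h3 ⟨⟨not_le.1 hc, h2⟩, h2⟩
  calc relPerimeter μ G ({x | τ < g x} ∩ G)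
      ≤ liminf (fun h : ℝ => μ.restrict G {x | τ ∈ crossedLevels g a b h x} /
          ENNReal.ofReal h) (𝓝[>] 0) := liminf_le_liminf (Eventually.of_forall key)
    _ ≤ _ := liminf_le_liminf_of_le hh

/-- The coarea inequality for Lipschitz functions, relative to a set `G`. -/
theorem lintegral_relPerimeter_le [MeasurableSpace Ω] [BorelSpace Ω] (μ : Measure Ω)
    [IsFiniteMeasure μ] {g : Ω → ℝ} {L : ℝ≥0} (hg : LipschitzWith L g)
    (hlev : ∀ c : ℝ, ∀ᵐ x ∂μ, g x = c → gradModulus g x = 0) {G : Set Ω} (hG : MeasurableSet G)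
    (a b : ℝ) :
    ∫⁻ τ in Ioo a b, relPerimeter μ G ({x | τ < g x} ∩ G) ≤
      ∫⁻ x in {x | a < g x ∧ g x < b} ∩ G, gradModulus g x ∂μ := by
  set h : ℕ → ℝ := fun n => 1 / ((n : ℝ) + 1) with hh
  have hpos : ∀ n, 0 < h n := fun n => by simp only [hh]; positivity
  have hD : MeasurableSet {x | a < g x ∧ g x < b} :=
    hg.continuous.measurable measurableSet_Ioo
  have hmeas := fun n => lintegral_measure_thickening_diff μ hg.continuous G a b (h n)
  have hlip : ∀ n x, volume (crossedLevels g a b (h n) x) / ENNReal.ofReal (h n) ≤ L := by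
    intro n x
    rw [ENNReal.div_le_iff (by simpa using hpos n) ENNReal.ofReal_ne_top]
    exact volume_crossedLevels_le fun y _ => hg x y
  calc ∫⁻ τ in Ioo a b, relPerimeter μ G ({x | τ < g x} ∩ G)
      ≤ ∫⁻ τ in Ioo a b, liminf (fun n : ℕ =>
          μ.restrict G {x | τ ∈ crossedLevels g a b (h n) x} / ENNReal.ofReal (h n)) atTop :=
        setLIntegral_mono' measurableSet_Ioo fun τ hτ => relPerimeter_superlevel_le μ hG hτ
    _ ≤ ∫⁻ τ, liminf (fun n : ℕ =>
          μ.restrict G {x | τ ∈ crossedLevels g a b (h n) x} / ENNReal.ofReal (h n)) atTop :=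
        setLIntegral_le_lintegral _ _
    -- Fatou in the level variable, then Tonelli to exchange levels and points, then reverse Fatou
    -- in `x` with the constant majorant `L`.
    _ ≤ liminf (fun n : ℕ => ∫⁻ τ,
          μ.restrict G {x | τ ∈ crossedLevels g a b (h n) x} / ENNReal.ofReal (h n)) atTop :=
        lintegral_liminf_le fun n => (hmeas n).1.div_const _
    _ = liminf (fun n : ℕ => ∫⁻ x in G,
          volume (crossedLevels g a b (h n) x) / ENNReal.ofReal (h n) ∂μ) atTop := by
        congr 1
        ext n
        simp only [div_eq_mul_inv]
        rw [lintegral_mul_const _ (hmeas n).1, lintegral_mul_const _ (hmeas n).2.1, (hmeas n).2.2]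
    _ ≤ limsup (fun n : ℕ => ∫⁻ x in G,
          volume (crossedLevels g a b (h n) x) / ENNReal.ofReal (h n) ∂μ) atTop :=
        liminf_le_limsup
    _ ≤ ∫⁻ x in G, limsup (fun n : ℕ =>
          volume (crossedLevels g a b (h n) x) / ENNReal.ofReal (h n)) atTop ∂μ := by
        refine limsup_lintegral_le (fun _ => (L : ℝ≥0∞)) (fun n => (hmeas n).2.1.div_const _)
          (fun n => Eventually.of_forall (hlip n)) ?_
        rw [lintegral_const]
        exact ENNReal.mul_ne_top ENNReal.coe_ne_top (measure_ne_top _ _)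
    _ ≤ ∫⁻ x in G, {x | a < g x ∧ g x < b}.indicator (gradModulus g) x ∂μ := by
        refine lintegral_mono_ae (ae_restrict_of_ae ?_)
        filter_upwards [hlev a] with x hx
        have hgrad : limsup (fun n : ℕ => volume (crossedLevels g a b (h n) x) /
            ENNReal.ofReal (h n)) atTop ≤ gradModulus g x := by
          refine le_of_forall_gt fun q hq => ?_
          obtain ⟨q', hq1, hq2⟩ := exists_between hq
          obtain ⟨ε, hε, hball⟩ :=
            Metric.eventually_nhds_iff_ball.1 (eventually_edist_le_of_gradModulus_lt hq1)
          refine (limsup_le_of_le (h := ?_)).trans_lt hq2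
          filter_upwards [tendsto_one_div_add_atTop_nhds_zero_nat.eventually_lt_const hε]
            with n hn
          rw [ENNReal.div_le_iff (by simpa using hpos n) ENNReal.ofReal_ne_top]
          exact volume_crossedLevels_le fun y hy =>
            hball y (Metric.ball_subset_ball (le_of_lt hn) hy)
        -- Below `a` small balls cross no level, and from `b` on none is ever crossed. On the level
        -- set `g = a` the gradient vanishes almost everywhere, which is why the open strip
        -- suffices.
        rcases lt_trichotomy (g x) a with hlt | heq | hgt
        · obtain ⟨ε, hε, hball⟩ := Metric.eventually_nhds_iff_ball.1
            (hg.continuous.continuousAt.eventually_lt continuousAt_const hlt)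
          refine (limsup_le_of_le (h := ?_)).trans zero_le
          filter_upwards [tendsto_one_div_add_atTop_nhds_zero_nat.eventually_lt_const hε]
            with n hn
          have : crossedLevels g a b (h n) x = ∅ := by
            ext τ
            simp only [mem_empty_iff_false, iff_false]
            rintro ⟨h1, -, h3⟩
            obtain ⟨y, hy, hxy⟩ := Metric.mem_thickening_iff.1 h3
            have := hball y (by rw [Metric.mem_ball, dist_comm]; exact hxy.trans hn)
            exact absurd (h1.1.trans hy) (not_lt.2 this.le)
          simp [this]
        · exact (hgrad.trans_eq (hx heq)).trans zero_le
        · rcases lt_or_ge (g x) b with hb | hb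
          · rwa [indicator_of_mem (show x ∈ {x | a < g x ∧ g x < b} from ⟨hgt, hb⟩)]
          · simp [crossedLevels_eq_empty_of_le hb]
    _ = ∫⁻ x in {x | a < g x ∧ g x < b} ∩ G, gradModulus g x ∂μ := by
        rw [lintegral_indicator hD, Measure.restrict_restrict hD]

end Coarea

/-! ### Rearrangement-invariant norms and Hölder's inequality. -/

section RINorm

variable {α β : Type*} [MeasurableSpace α] [MeasurableSpace β]

theorem distribution_indicator_one (μ : Measure α) (A : Set α) (t : ℝ≥0∞) :
    distribution μ (A.indicator 1) t = if t < 1 then μ A else 0 := by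
  rw [distribution]
  split_ifs with h
  · congr 1
    ext x
    by_cases hx : x ∈ A <;> simp [hx, h]
  · convert measure_empty (μ := μ)
    ext x
    by_cases hx : x ∈ A <;> simp [hx, not_lt.1 h]

theorem Equimeasurable.const_mul {μ : Measure α} {ν : Measure β} {f : α → ℝ≥0∞} {g : β → ℝ≥0∞}
    (h : Equimeasurable μ f ν g) {c : ℝ≥0} (hc : c ≠ 0) :
    Equimeasurable μ (fun x => (c : ℝ≥0∞) * f x) ν (fun x => (c : ℝ≥0∞) * g x) := by
  intro t
  have h1 : ∀ y : ℝ≥0∞, t < c * y ↔ t / c < y := fun y => by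
    rw [ENNReal.div_lt_iff (Or.inl (by simpa using hc)) (Or.inl ENNReal.coe_ne_top), mul_comm]
  simp only [distribution, h1]
  exact h (t / c)

/-- The image measures on `ℝ≥0∞` agree on the π-system of rays `Ioi t` and have the same finite
mass, so they coincide. -/
theorem Equimeasurable.lintegral_eq {μ : Measure α} [IsFiniteMeasure μ] {ν : Measure β}
    [IsFiniteMeasure ν] {f : α → ℝ≥0∞} {g : β → ℝ≥0∞} (h : Equimeasurable μ f ν g)
    (huniv : μ univ = ν univ) (hf : AEMeasurable f μ) (hg : AEMeasurable g ν) :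
    ∫⁻ x, f x ∂μ = ∫⁻ y, g y ∂ν := by
  have hmap : μ.map f = ν.map g := by
    have : IsFiniteMeasure (μ.map f) := inferInstance
    refine ext_of_generate_finite (range Ioi) (borel_eq_generateFrom_Ioi ℝ≥0∞ ▸
      BorelSpace.measurable_eq) isPiSystem_Ioi ?_ ?_
    · rintro _ ⟨t, rfl⟩
      rw [Measure.map_apply_of_aemeasurable hf measurableSet_Ioi,
        Measure.map_apply_of_aemeasurable hg measurableSet_Ioi]
      exact h t
    · rw [Measure.map_apply_of_aemeasurable hf MeasurableSet.univ,
        Measure.map_apply_of_aemeasurable hg MeasurableSet.univ]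
      exact huniv
  calc ∫⁻ x, f x ∂μ = ∫⁻ y, y ∂(μ.map f) := (lintegral_map' aemeasurable_id hf).symm
    _ = ∫⁻ y, y ∂(ν.map g) := by rw [hmap]
    _ = ∫⁻ y, g y ∂ν := lintegral_map' aemeasurable_id hg

instance (μ : Measure α) : IsFiniteMeasure (intervalMeasure μ) := by
  unfold intervalMeasure
  infer_instance

theorem intervalMeasure_univ (μ : Measure α) [IsFiniteMeasure μ] :
    intervalMeasure μ univ = μ univ := by
  simp [intervalMeasure]

theorem antitone_rearrangement (μ : Measure α) (f : α → ℝ≥0∞) : Antitone (rearrangement μ f) :=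
  fun _ _ hab => sInf_le_sInf fun _ ht => le_trans ht (ENNReal.ofReal_le_ofReal hab)

theorem rearrangement_eq_zero {μ : Measure α} {f : α → ℝ≥0∞} {s : ℝ}
    (h : μ {x | 0 < f x} ≤ ENNReal.ofReal s) : rearrangement μ f s = 0 :=
  le_antisymm (sInf_le h) zero_le

variable {μ : Measure α} {ρ : (α → ℝ≥0∞) → ℝ≥0∞}

theorem IsRINorm.congr (hρ : IsRINorm μ ρ) {f g : α → ℝ≥0∞} (hf : AEMeasurable f μ)
    (hg : AEMeasurable g μ) (h : f =ᵐ[μ] g) : ρ f = ρ g :=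
  le_antisymm (hρ.mono f g hf hg h.le) (hρ.mono g f hg hf h.symm.le)

theorem IsRINorm.indicator_eq (hρ : IsRINorm μ ρ) {A B : Set α} (hA : MeasurableSet A)
    (hB : MeasurableSet B) (h : μ A = μ B) : ρ (A.indicator 1) = ρ (B.indicator 1) := by
  refine hρ.rearrangement_invariant _ _ (measurable_one.indicator hA).aemeasurable
    (measurable_one.indicator hB).aemeasurable fun t => ?_
  rw [distribution_indicator_one, distribution_indicator_one, h]

theorem fundamentalFunction_eq (hρ : IsRINorm μ ρ) {A : Set α} (hA : MeasurableSet A) {t : ℝ}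
    (h : μ A = ENNReal.ofReal t) : fundamentalFunction μ ρ t = ρ (A.indicator 1) := by
  refine le_antisymm (iInf₂_le_of_le A hA (iInf_le _ h)) ?_
  exact le_iInf fun B => le_iInf fun hB => le_iInf fun hBt =>
    (hρ.indicator_eq hA hB (h.trans hBt.symm)).le

theorem fundamentalFunction_ne_zero (hρ : IsRINorm μ ρ) {t : ℝ} (h0 : 0 < t) :
    fundamentalFunction μ ρ t ≠ 0 := by
  by_cases h : ∃ A : Set α, MeasurableSet A ∧ μ A = ENNReal.ofReal t
  · obtain ⟨A, hA, hAt⟩ := h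
    rw [fundamentalFunction_eq hρ hA hAt, Ne,
      hρ.eq_zero_iff _ (measurable_one.indicator hA).aemeasurable, indicator_ae_eq_zero]
    simp [hAt, h0]
  -- With no set of measure `t` the infimum is over an empty family and equals `∞`.
  · push Not at h
    simp only [fundamentalFunction]
    intro h'
    have : (⨅ (A : Set α) (_ : MeasurableSet A) (_ : μ A = ENNReal.ofReal t),
        ρ (A.indicator 1)) = ⊤ :=
      iInf_eq_top.2 fun A => iInf_eq_top.2 fun hA => iInf_eq_top.2 fun hAt => absurd hAt (h A hA)
    simp [this] at h'

/-- Hölder's inequality for the representation space and its associate space. -/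
theorem lintegral_mul_le_associateNorm (hρ : IsRINorm μ ρ) {f : α → ℝ≥0∞}
    (hf : AEMeasurable f μ) (hfin : ρ f ≠ ∞) {g : ℝ → ℝ≥0∞}
    (hg : AEMeasurable g (intervalMeasure μ)) (h : Equimeasurable μ f (intervalMeasure μ) g)
    (w : ℝ → ℝ≥0∞) :
    ∫⁻ s, g s * w s ∂(intervalMeasure μ) ≤
      ρ f * associateNorm (intervalMeasure μ) (representationNorm μ ρ) w := by
  rcases eq_or_ne (ρ f) 0 with h0 | h0
  · have hf0 := (hρ.eq_zero_iff f hf).1 h0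
    have hg0 : g =ᵐ[intervalMeasure μ] 0 := by
      have h1 : distribution μ f 0 = 0 := by
        refine measure_mono_null (fun x hx => ?_) (ae_iff.1 hf0)
        exact ne_of_gt hx
      have h2 := (h 0).symm.trans h1
      refine ae_iff.2 (measure_mono_null (fun x hx => ?_) h2)
      exact pos_iff_ne_zero.2 hx
    have : ∫⁻ s, g s * w s ∂(intervalMeasure μ) = ∫⁻ s, 0 ∂(intervalMeasure μ) := by
      refine lintegral_congr_ae ?_
      filter_upwards [hg0] with s hs
      simp [hs]
    simp [this]
  · set c : ℝ≥0 := (ρ f).toNNReal⁻¹ with hc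
    have hc0 : c ≠ 0 := inv_ne_zero (by simp [ENNReal.toNNReal_eq_zero_iff, h0, hfin])
    have hcf : (c : ℝ≥0∞) = (ρ f)⁻¹ := by
      rw [hc, ENNReal.coe_inv (by simp [ENNReal.toNNReal_eq_zero_iff, h0, hfin]),
        ENNReal.coe_toNNReal hfin]
    -- After scaling by `1 / ρ f`, the multiple of `f` witnesses that `g` lies in the unit ball, so
    -- it competes in the associate norm.
    have hle : representationNorm μ ρ (fun s => (c : ℝ≥0∞) * g s) ≤ 1 := by
      refine (iInf₂_le_of_le (fun x => (c : ℝ≥0∞) * f x) (hf.const_mul _)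
        (iInf_le _ (h.const_mul hc0))).trans ?_
      rw [hρ.const_mul c f hf, hcf, ENNReal.inv_mul_cancel h0 hfin]
    have key : ∫⁻ s, (c : ℝ≥0∞) * g s * w s ∂(intervalMeasure μ) ≤
        associateNorm (intervalMeasure μ) (representationNorm μ ρ) w :=
      le_iSup₂_of_le (fun s => (c : ℝ≥0∞) * g s) (hg.const_mul _) (le_iSup_of_le hle le_rfl)
    simp only [mul_assoc] at key
    rw [lintegral_const_mul' _ _ ENNReal.coe_ne_top, hcf] at key
    rwa [← ENNReal.inv_mul_le_iff h0 hfin]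

/-- The value `g s` bounds `g` from below on `(0, s)` and from above on `[s, 2s)`, so the second
half contributes no more than the first. -/
theorem setLIntegral_Ioo_two_mul_le {g : ℝ → ℝ≥0∞} (hg : Antitone g) (s : ℝ) :
    ∫⁻ t in Ioo 0 (2 * s), g t ≤ 2 * ∫⁻ t in Ioo 0 s, g t := by
  have h1 : ENNReal.ofReal s * g s ≤ ∫⁻ t in Ioo 0 s, g t := by
    calc ENNReal.ofReal s * g s = ∫⁻ _ in Ioo 0 s, g s := by simp [mul_comm]
      _ ≤ _ := setLIntegral_mono' measurableSet_Ioo fun t ht => hg ht.2.le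
  have h2 : ∫⁻ t in Ico s (2 * s), g t ≤ ENNReal.ofReal s * g s := by
    calc ∫⁻ t in Ico s (2 * s), g t ≤ ∫⁻ _ in Ico s (2 * s), g s :=
        setLIntegral_mono' measurableSet_Ico fun t ht => hg ht.1
      _ = _ := by
        rw [setLIntegral_const, Real.volume_Ico, mul_comm, two_mul, add_sub_cancel_right]
  calc ∫⁻ t in Ioo 0 (2 * s), g t ≤ ∫⁻ t in Ioo 0 s ∪ Ico s (2 * s), g t := by
        refine lintegral_mono_set fun t ht => ?_
        rcases lt_or_ge t s with h | h
        · exact Or.inl ⟨ht.1, h⟩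
        · exact Or.inr ⟨h, ht.2⟩
    _ ≤ _ := lintegral_union_le _ _ _
    _ ≤ _ := (add_le_add le_rfl (h2.trans h1)).trans_eq (two_mul _).symm

end RINorm

/-! ### Growth of the fundamental function and the weak-type estimate. -/

section Fundamental

variable {Ω : Type*} [MetricSpace Ω] [MeasurableSpace Ω] [BorelSpace Ω] {μ : Measure Ω}
  [IsFiniteMeasure μ] [NullSingletonClass μ] {ρ : (Ω → ℝ≥0∞) → ℝ≥0∞}

theorem fundamentalFunction_mono (hρ : IsRINorm μ ρ)
    (hsep : ∃ S : Set Ω, TopologicalSpace.IsSeparable S ∧ μ Sᶜ = 0) {t t' : ℝ} (h : t ≤ t') :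
    fundamentalFunction μ ρ t ≤ fundamentalFunction μ ρ t' := by
  refine le_iInf fun B => le_iInf fun hB => le_iInf fun hBt => ?_
  obtain ⟨A, hAB, hA, hAt⟩ := exists_measurable_subset_measure_eq μ hsep hB
    (s := ENNReal.ofReal t) (by rw [hBt]; exact ENNReal.ofReal_le_ofReal h)
  rw [fundamentalFunction_eq hρ hA hAt]
  exact hρ.mono _ _ (measurable_one.indicator hA).aemeasurable
    (measurable_one.indicator hB).aemeasurable
    (Eventually.of_forall (indicator_le_indicator_of_subset hAB fun _ => zero_le))

/-- A set of measure `2t` built from two disjoint sets of measure `t`, and the triangle inequality.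
-/
theorem fundamentalFunction_two_mul_le (hρ : IsRINorm μ ρ)
    (hsep : ∃ S : Set Ω, TopologicalSpace.IsSeparable S ∧ μ Sᶜ = 0) {t : ℝ} (h0 : 0 ≤ t)
    (h : 2 * t ≤ (μ univ).toReal) :
    fundamentalFunction μ ρ (2 * t) ≤ 2 * fundamentalFunction μ ρ t := by
  have hle : ENNReal.ofReal t + ENNReal.ofReal t ≤ μ univ := by
    rw [← ENNReal.ofReal_add h0 h0, ← two_mul]
    exact ENNReal.ofReal_le_of_le_toReal h
  obtain ⟨A, -, hA, hAt⟩ := exists_measurable_subset_measure_eq μ hsep MeasurableSet.univ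
    (s := ENNReal.ofReal t) (le_self_add.trans hle)
  obtain ⟨B, hBA, hB, hBt⟩ := exists_measurable_subset_measure_eq μ hsep hA.compl
    (s := ENNReal.ofReal t) (by
      rw [measure_compl hA (measure_ne_top _ _), hAt]
      exact ENNReal.le_sub_of_add_le_left ENNReal.ofReal_ne_top hle)
  have hdisj : Disjoint A B := disjoint_left.2 fun x hxA hxB => hBA hxB hxA
  have hU : μ (A ∪ B) = ENNReal.ofReal (2 * t) := by
    rw [measure_union hdisj hB, hAt, hBt, ← ENNReal.ofReal_add h0 h0, two_mul]
  rw [fundamentalFunction_eq hρ (hA.union hB) hU, two_mul]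
  conv_rhs => rw [fundamentalFunction_eq hρ hA hAt]
  have : (A ∪ B).indicator (1 : Ω → ℝ≥0∞) = fun x => A.indicator 1 x + B.indicator 1 x :=
    indicator_union_of_disjoint hdisj 1
  rw [this]
  refine (hρ.add_le _ _ (measurable_one.indicator hA).aemeasurable
    (measurable_one.indicator hB).aemeasurable).trans_eq ?_
  rw [hρ.indicator_eq hA hB (hAt.trans hBt.symm)]

theorem fundamentalFunction_ne_top (hρ : IsRINorm μ ρ)
    (hsep : ∃ S : Set Ω, TopologicalSpace.IsSeparable S ∧ μ Sᶜ = 0) {t : ℝ}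
    (h : t ≤ (μ univ).toReal) : fundamentalFunction μ ρ t ≠ ∞ := by
  obtain ⟨A, -, hA, hAt⟩ := exists_measurable_subset_measure_eq μ hsep MeasurableSet.univ
    (s := ENNReal.ofReal t) (ENNReal.ofReal_le_of_le_toReal h)
  rw [fundamentalFunction_eq hρ hA hAt]
  exact (hρ.indicator_lt_top A hA (measure_lt_top _ _)).ne

/-- The weak-type estimate for the level sets of an element of `X`. -/
theorem mul_fundamentalFunction_le (hρ : IsRINorm μ ρ)
    (hsep : ∃ S : Set Ω, TopologicalSpace.IsSeparable S ∧ μ Sᶜ = 0) {u : Ω → ℝ≥0∞}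
    (hu : Measurable u) {c : ℝ≥0} {s : ℝ} (h : ENNReal.ofReal s ≤ μ {x | (c : ℝ≥0∞) < u x}) :
    c * fundamentalFunction μ ρ s ≤ ρ u := by
  obtain ⟨A, hAu, hA, hAs⟩ := exists_measurable_subset_measure_eq μ hsep
    (measurableSet_lt measurable_const hu) h
  have h1 := (measurable_one.indicator hA).aemeasurable (f := A.indicator (1 : Ω → ℝ≥0∞)) (μ := μ)
  rw [fundamentalFunction_eq hρ hA hAs, ← hρ.const_mul c _ h1]
  refine hρ.mono _ _ (h1.const_mul _) hu.aemeasurable (Eventually.of_forall fun x => ?_)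
  by_cases hx : x ∈ A
  · simpa [hx] using (show (c : ℝ≥0∞) < u x from hAu hx).le
  · simp [hx]

end Fundamental

/-! ### Integrals over small sets in terms of the reciprocal profile. -/

section RecipProfileNorm

variable {Ω : Type*} [MetricSpace Ω] [MeasurableSpace Ω] {μ : Measure Ω} [IsFiniteMeasure μ]
  {ρ : (Ω → ℝ≥0∞) → ℝ≥0∞}

/-- The rearrangement of `F` cut off to `D` lives on `(0, 2s)`, and halving the interval costs a
factor 2. On `(0, s)` one inserts `1 ≤ I(s) / I(σ)` and applies Hölder. -/
theorem setLIntegral_le_mul_recipProfileNorm (hρ : IsRINorm μ ρ) {F : Ω → ℝ≥0∞}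
    (hF : AEMeasurable F μ) (hfin : ρ F ≠ ∞) {D : Set Ω} (hD : MeasurableSet D) {s : ℝ}
    (hs : 0 < s) (hsM : 2 * s ≤ (μ univ).toReal) (hDs : μ D ≤ ENNReal.ofReal (2 * s))
    (hprof : ∀ σ ∈ Ioo 0 s, profile μ σ ≤ profile μ s) (hp0 : profile μ s ≠ 0)
    (hpt : profile μ s ≠ ∞) :
    ∫⁻ x in D, F x ∂μ ≤ 2 * profile μ s * (recipProfileNorm μ ρ s * ρ F) := by
  set F' := D.indicator F with hF'
  have hF'm : AEMeasurable F' μ := hF.indicator hD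
  have hF'le : ρ F' ≤ ρ F :=
    hρ.mono _ _ hF'm hF (Eventually.of_forall fun x => indicator_le_self _ _ x)
  set R := rearrangement μ F' with hR
  have hRa : Antitone R := antitone_rearrangement μ F'
  have hRm : Measurable R := hRa.measurable
  have hR0 : ∀ σ, 2 * s ≤ σ → R σ = 0 := fun σ hσ => by
    refine rearrangement_eq_zero ((measure_mono fun x hx => ?_).trans
      (hDs.trans (ENNReal.ofReal_le_ofReal hσ)))
    by_contra hxD
    simp [hF', hxD] at hx
  have h1 : ∫⁻ x in D, F x ∂μ = ∫⁻ σ, R σ ∂(intervalMeasure μ) := by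
    rw [← lintegral_indicator hD]
    exact (equimeasurable_rearrangement μ F').lintegral_eq (intervalMeasure_univ μ).symm hF'm
      hRm.aemeasurable
  have h2 : ∫⁻ σ, R σ ∂(intervalMeasure μ) ≤ ∫⁻ σ in Ioo 0 (2 * s), R σ := by
    rw [intervalMeasure, ← lintegral_indicator measurableSet_Ioo,
      ← lintegral_indicator measurableSet_Ioo]
    refine lintegral_mono fun σ => ?_
    by_cases hσ : σ ∈ Ioo 0 (2 * s)
    · rw [indicator_of_mem hσ]
      exact indicator_le_self _ _ _
    · rw [indicator_of_notMem hσ]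
      by_cases h0 : 0 < σ
      · simp [indicator, hR0 σ (not_lt.1 fun h => hσ ⟨h0, h⟩)]
      · simp [indicator, h0]
  have h3 : ∫⁻ σ in Ioo 0 s, R σ ≤
      profile μ s * ∫⁻ σ, R σ * (Ioo 0 s).indicator (fun σ => (profile μ σ)⁻¹) σ
        ∂(intervalMeasure μ) := by
    rw [← lintegral_const_mul' _ _ hpt, intervalMeasure]
    calc ∫⁻ σ in Ioo 0 s, R σ ≤ ∫⁻ σ in Ioo 0 s,
          profile μ s * (R σ * (Ioo 0 s).indicator (fun σ => (profile μ σ)⁻¹) σ) := by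
          refine setLIntegral_mono' measurableSet_Ioo fun σ hσ => ?_
          rw [indicator_of_mem hσ]
          calc R σ = R σ * (profile μ s * (profile μ s)⁻¹) := by
                rw [ENNReal.mul_inv_cancel hp0 hpt, mul_one]
            _ ≤ R σ * (profile μ s * (profile μ σ)⁻¹) := by
                gcongr
                exact hprof σ hσ
            _ = _ := by ring
      _ ≤ _ := lintegral_mono_set (Ioo_subset_Ioo_right (by linarith))
  calc ∫⁻ x in D, F x ∂μ ≤ 2 * ∫⁻ σ in Ioo 0 s, R σ :=
        h1.le.trans (h2.trans (setLIntegral_Ioo_two_mul_le hRa s))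
    _ ≤ 2 * (profile μ s * (ρ F' * recipProfileNorm μ ρ s)) := by
        gcongr
        refine h3.trans ?_
        gcongr
        exact lintegral_mul_le_associateNorm hρ hF'm (ne_top_of_le_ne_top hfin hF'le)
          hRm.aemeasurable (equimeasurable_rearrangement μ F') _
    _ ≤ 2 * (profile μ s * (ρ F * recipProfileNorm μ ρ s)) := by gcongr
    _ = _ := by ring

end RecipProfileNorm

/-! ### Consequences of concavity and symmetry of the profile. -/

section Profile

variable {Ω : Type*} [MetricSpace Ω] [MeasurableSpace Ω] {μ : Measure Ω}

/-- On `[y, μ(Ω) - y]` a concave function is at least the smaller endpoint value, and by symmetry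
the endpoint values agree. -/
theorem StandardAssumptions.profile_le (h : StandardAssumptions μ) {y x : ℝ} (h0 : 0 ≤ y)
    (hyx : y ≤ x) (hx : x ≤ (μ univ).toReal - y) : profile μ y ≤ profile μ x := by
  have hy : y ∈ Icc 0 (μ univ).toReal := ⟨h0, by linarith⟩
  have hy' : (μ univ).toReal - y ∈ Icc 0 (μ univ).toReal := ⟨by linarith, by linarith⟩
  rw [← ENNReal.toReal_le_toReal (h.profile_ne_top y hy)
    (h.profile_ne_top x ⟨by linarith, by linarith⟩)]
  have := h.profile_concave.min_le_of_mem_Icc hy hy' ⟨hyx, hx⟩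
  simpa only [h.profile_symm y hy, min_self] using this

theorem StandardAssumptions.mul_profile_le (h : StandardAssumptions μ) {θ s : ℝ} (hθ0 : 0 ≤ θ)
    (hθ1 : θ ≤ 1) (hs : s ∈ Icc 0 (μ univ).toReal) :
    ENNReal.ofReal θ * profile μ s ≤ profile μ (θ * s) := by
  have h0 : (0 : ℝ) ∈ Icc 0 (μ univ).toReal := ⟨le_rfl, ENNReal.toReal_nonneg⟩
  have hθs : θ * s ∈ Icc 0 (μ univ).toReal :=
    ⟨mul_nonneg hθ0 hs.1, (mul_le_of_le_one_left hs.1 hθ1).trans hs.2⟩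
  have := h.profile_concave.2 hs h0 hθ0 (sub_nonneg.2 hθ1) (by ring)
  simp only [smul_eq_mul, mul_zero, add_zero, h.profile_zero, ENNReal.toReal_zero] at this
  rw [← ENNReal.toReal_le_toReal (ENNReal.mul_ne_top ENNReal.ofReal_ne_top
    (h.profile_ne_top s hs)) (h.profile_ne_top _ hθs), ENNReal.toReal_mul,
    ENNReal.toReal_ofReal hθ0]
  exact this

/-- A zero at `s` would, by concavity and `I(0) = 0`, force `I = 0` on `(s, μ(Ω))`. Testing `1/I =
∞` there against the constant 1 contradicts finiteness of the associate norm. -/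
theorem profile_ne_zero [IsFiniteMeasure μ] (h : StandardAssumptions μ)
    {ρ : (Ω → ℝ≥0∞) → ℝ≥0∞} (hρ : IsRINorm μ ρ)
    (hI : associateNorm (intervalMeasure μ) (representationNorm μ ρ)
      (fun s => (profile μ s)⁻¹) < ∞) {s : ℝ} (hs : s ∈ Ioo 0 (μ univ).toReal) :
    profile μ s ≠ 0 := by
  intro hzero
  have hz : ∀ σ ∈ Ioo s (μ univ).toReal, profile μ σ = 0 := by
    intro σ hσ
    have hσ0 : 0 < σ := hs.1.trans hσ.1
    have h1 := h.mul_profile_le (θ := s / σ) (div_nonneg hs.1.le hσ0.le)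
      ((div_le_one hσ0).2 hσ.1.le) ⟨hσ0.le, hσ.2.le⟩
    rw [div_mul_cancel₀ _ hσ0.ne', hzero, nonpos_iff_eq_zero, mul_eq_zero] at h1
    exact h1.resolve_left (by simpa using div_pos hs.1 hσ0)
  have hone : ρ (fun _ => 1) ≠ ∞ := by
    have := hρ.indicator_lt_top univ MeasurableSet.univ (measure_lt_top _ _)
    rw [indicator_univ] at this
    exact this.ne
  have hequi : Equimeasurable μ (fun _ => 1) (intervalMeasure μ) (fun _ => 1) := by
    intro t
    by_cases ht : t < 1 <;> simp [distribution, ht, intervalMeasure_univ]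
  have h2 := lintegral_mul_le_associateNorm hρ aemeasurable_const hone aemeasurable_const hequi
    (fun s => (profile μ s)⁻¹)
  have h3 : ∫⁻ σ, 1 * (profile μ σ)⁻¹ ∂(intervalMeasure μ) = ∞ := by
    refine top_le_iff.1 ?_
    calc (∞ : ℝ≥0∞) = ∫⁻ _ in Ioo s (μ univ).toReal, ∞ := by
          rw [setLIntegral_const, Real.volume_Ioo, ENNReal.top_mul]
          simpa using hs.2
      _ = ∫⁻ σ in Ioo s (μ univ).toReal, 1 * (profile μ σ)⁻¹ :=
          setLIntegral_congr_fun measurableSet_Ioo fun σ hσ => by simp [hz σ hσ]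
      _ ≤ _ := lintegral_mono_set (Ioo_subset_Ioo_left hs.1.le)
  rw [h3, top_le_iff] at h2
  exact ENNReal.mul_ne_top hone hI.ne h2

end Profile

/-! ### The estimate at one scale. -/

section SingleScale

variable {Ω : Type*} [MetricSpace Ω] [MeasurableSpace Ω] [BorelSpace Ω] {μ : Measure Ω}
  [IsFiniteMeasure μ] {ρ : (Ω → ℝ≥0∞) → ℝ≥0∞}

/-- Two levels of a Lipschitz function, between which its distribution function on `G` stays
comparable to `s`, differ by at most a multiple of `‖χ_(0,s) / I_Ω‖ ‖|∇g|‖`. -/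
theorem levels_gap_le (hstd : StandardAssumptions μ)
    (hpos : ∀ t ∈ Ioo 0 (μ univ).toReal, profile μ t ≠ 0) (hρ : IsRINorm μ ρ)
    {G : Set Ω} (hG : MeasurableSet G) {α : ℝ} (hα : μ G = ENNReal.ofReal α) {C : ℝ≥0}
    (hC : C ≠ 0) (hrel : ∀ s ∈ Ioo 0 α,
      C * min (profile μ s) (profile μ (α - s)) ≤ relProfile μ G s)
    {s : ℝ} (hs : 0 < s) (hsα : 2 * s ≤ α) {g : Ω → ℝ} (hg : g ∈ lipClass ρ) {a b : ℝ}
    (ha : μ ({x | a < g x} ∩ G) ≤ ENNReal.ofReal (5 / 4 * s))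
    (hb : ENNReal.ofReal (s / 4) ≤ μ ({x | b ≤ g x} ∩ G)) :
    ENNReal.ofReal (b - a) ≤
      8 * (C : ℝ≥0∞)⁻¹ * (recipProfileNorm μ ρ s * ρ (gradModulus g)) := by
  obtain ⟨L, hL⟩ := hg.1
  have hgm : Measurable g := hL.continuous.measurable
  have hαM : α ≤ (μ univ).toReal := by
    have h1 : μ G ≤ μ univ := measure_mono (subset_univ _)
    rw [hα] at h1
    exact (ENNReal.ofReal_le_iff_le_toReal (measure_ne_top _ _)).1 h1
  have hq0 : profile μ (s / 4) ≠ 0 := hpos _ ⟨by linarith, by linarith⟩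
  have hqt : profile μ (s / 4) ≠ ∞ := hstd.profile_ne_top _ ⟨by linarith, by linarith⟩
  have hper : ∀ τ ∈ Ioo a b, C * profile μ (s / 4) ≤ relPerimeter μ G ({x | τ < g x} ∩ G) := by
    intro τ hτ
    have hm1 : ENNReal.ofReal (s / 4) ≤ μ ({x | τ < g x} ∩ G) :=
      hb.trans (measure_mono (inter_subset_inter_left _ fun x hx => hτ.2.trans_le hx))
    have hm2 : μ ({x | τ < g x} ∩ G) ≤ ENNReal.ofReal (5 / 4 * s) :=
      (measure_mono (inter_subset_inter_left _ fun x hx => hτ.1.trans hx)).trans ha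
    set m := (μ ({x | τ < g x} ∩ G)).toReal with hm
    have hmeq : μ ({x | τ < g x} ∩ G) = ENNReal.ofReal m :=
      (ENNReal.ofReal_toReal (measure_ne_top _ _)).symm
    have hm1' : s / 4 ≤ m := (ENNReal.ofReal_le_iff_le_toReal (measure_ne_top _ _)).1 hm1
    have hm2' : m ≤ 5 / 4 * s := ENNReal.toReal_le_of_le_ofReal (by linarith) hm2
    -- From `s/4 ≤ m ≤ 5s/4` and `2s ≤ α`, both `m` and `α - m` lie in `[s/4, μ(Ω) - s/4]`, where
    -- the profile is at least `I(s/4)`.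
    calc C * profile μ (s / 4) ≤ C * min (profile μ m) (profile μ (α - m)) := by
          gcongr
          exact le_min (hstd.profile_le (by linarith) hm1' (by linarith))
            (hstd.profile_le (by linarith) (by linarith) (by linarith))
      _ ≤ relProfile μ G m := hrel m ⟨by linarith, by linarith⟩
      _ ≤ _ := iInf₂_le_of_le _ ((measurableSet_lt measurable_const hgm).inter hG)
          (iInf₂_le_of_le inter_subset_right hmeq le_rfl)
  have hD : MeasurableSet ({x | a < g x ∧ g x < b} ∩ G) := (hgm measurableSet_Ioo).inter hG
  have key : ENNReal.ofReal (b - a) * (C * profile μ (s / 4)) ≤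
      8 * profile μ (s / 4) * (recipProfileNorm μ ρ s * ρ (gradModulus g)) := by
    calc ENNReal.ofReal (b - a) * (C * profile μ (s / 4))
        = ∫⁻ _ in Ioo a b, C * profile μ (s / 4) := by
          rw [setLIntegral_const, Real.volume_Ioo, mul_comm]
      _ ≤ ∫⁻ τ in Ioo a b, relPerimeter μ G ({x | τ < g x} ∩ G) :=
          setLIntegral_mono' measurableSet_Ioo hper
      _ ≤ ∫⁻ x in {x | a < g x ∧ g x < b} ∩ G, gradModulus g x ∂μ :=
          lintegral_relPerimeter_le μ hL (hstd.grad_level g hg.1) hG a b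
      _ ≤ 2 * profile μ s * (recipProfileNorm μ ρ s * ρ (gradModulus g)) := by
          refine setLIntegral_le_mul_recipProfileNorm hρ
            (measurable_gradModulus hL.continuous).aemeasurable hg.2.ne hD hs (by linarith) ?_ ?_
            (hpos _ ⟨hs, by linarith⟩) (hstd.profile_ne_top _ ⟨hs.le, by linarith⟩)
          · exact (measure_mono (inter_subset_inter_left _ fun x hx => hx.1)).trans
              (ha.trans (ENNReal.ofReal_le_ofReal (by linarith)))
          · exact fun σ hσ => hstd.profile_le hσ.1.le hσ.2.le (by linarith [hσ.2])
      _ ≤ _ := by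
          refine mul_le_mul_left ?_ _
          have h1 := hstd.mul_profile_le (θ := 1 / 4) (s := s) (by norm_num) (by norm_num)
            ⟨hs.le, by linarith⟩
          rw [one_div_mul_eq_div] at h1
          -- Concavity trades `I(s)` for `4 I(s/4)`; this is the origin of the constant 8.
          calc 2 * profile μ s = 8 * (ENNReal.ofReal (1 / 4) * profile μ s) := by
                rw [← mul_assoc]
                congr 1
                rw [← ENNReal.ofReal_ofNat 8, ← ENNReal.ofReal_mul (by norm_num)]
                norm_num
            _ ≤ _ := by gcongr
  have hC0 : (C : ℝ≥0∞) ≠ 0 := by simpa using hC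
  have h2 := mul_le_mul_left key ((C : ℝ≥0∞)⁻¹ * (profile μ (s / 4))⁻¹)
  calc ENNReal.ofReal (b - a)
      = ENNReal.ofReal (b - a) * (C * profile μ (s / 4)) *
          ((C : ℝ≥0∞)⁻¹ * (profile μ (s / 4))⁻¹) := by
        rw [mul_assoc, mul_mul_mul_comm, ENNReal.mul_inv_cancel hC0 ENNReal.coe_ne_top,
          ENNReal.mul_inv_cancel hq0 hqt, one_mul, mul_one]
    _ ≤ _ := h2
    _ = 8 * (C : ℝ≥0∞)⁻¹ * (recipProfileNorm μ ρ s * ρ (gradModulus g)) *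
          (profile μ (s / 4) * (profile μ (s / 4))⁻¹) := by ring
    _ = _ := by rw [ENNReal.mul_inv_cancel hq0 hqt, mul_one]

/-- The quotient `K(φ_X(t) ‖χ_(0,t) / I_Ω‖, f) / φ_X(t)`. -/
noncomputable def kRate (μ : Measure Ω) (ρ : (Ω → ℝ≥0∞) → ℝ≥0∞) (f : Ω → ℝ) (t : ℝ) : ℝ≥0∞ :=
  kFunctional ρ (fundamentalFunction μ ρ t * recipProfileNorm μ ρ t) f / fundamentalFunction μ ρ t

variable [NullSingletonClass μ]

/-- Consecutive quantiles of `f` on `G` are controlled by the K-functional. -/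
theorem quantile_gap_le (hstd : StandardAssumptions μ)
    (hpos : ∀ t ∈ Ioo 0 (μ univ).toReal, profile μ t ≠ 0) (hρ : IsRINorm μ ρ)
    {G : Set Ω} (hG : MeasurableSet G) {α : ℝ} (hα : μ G = ENNReal.ofReal α) {C : ℝ≥0}
    (hC : C ≠ 0) (hrel : ∀ s ∈ Ioo 0 α,
      C * min (profile μ s) (profile μ (α - s)) ≤ relProfile μ G s)
    {f : Ω → ℝ} (hf : Measurable f) {s : ℝ} (hs : 0 < s) (hsα : 2 * s ≤ α) {c d : ℝ}
    (hc : μ ({x | c < f x} ∩ G) ≤ ENNReal.ofReal s)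
    (hd : ENNReal.ofReal (s / 2) ≤ μ ({x | d ≤ f x} ∩ G)) :
    ENNReal.ofReal (d - c) ≤ 8 * (1 + (C : ℝ≥0∞)⁻¹) * kRate μ ρ f s := by
  have hαM : α ≤ (μ univ).toReal := by
    have h1 : μ G ≤ μ univ := measure_mono (subset_univ _)
    rw [hα] at h1
    exact (ENNReal.ofReal_le_iff_le_toReal (measure_ne_top _ _)).1 h1
  have hφ0 := fundamentalFunction_ne_zero hρ hs
  have hφt := fundamentalFunction_ne_top hρ hstd.separable (t := s) (by linarith)
  have hφ0' := fundamentalFunction_ne_zero hρ (t := s / 4) (by linarith)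
  have hφt' := fundamentalFunction_ne_top hρ hstd.separable (t := s / 4) (by linarith)
  set φ := fundamentalFunction μ ρ s with hφ
  set φ' := fundamentalFunction μ ρ (s / 4) with hφ'
  have hφφ : φ ≤ 4 * φ' := by
    have h1 := fundamentalFunction_two_mul_le hρ hstd.separable (t := s / 2) (by linarith)
      (by linarith)
    have h2 := fundamentalFunction_two_mul_le hρ hstd.separable (t := s / 4) (by linarith)
      (by linarith)
    rw [show 2 * (s / 2) = s by ring] at h1
    rw [show 2 * (s / 4) = s / 2 by ring] at h2
    calc φ ≤ 2 * (2 * φ') := h1.trans (by gcongr)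
      _ = 4 * φ' := by rw [← mul_assoc]; norm_num
  set Q : ℝ≥0∞ := 8 * (1 + (C : ℝ≥0∞)⁻¹) with hQ
  have hC0 : (C : ℝ≥0∞) ≠ 0 := by simpa using hC
  have hQ0 : Q ≠ 0 := by simp [hQ]
  have hQt : Q ≠ ∞ := ENNReal.mul_ne_top (by simp) (by simp [hC])
  have key : ∀ g ∈ lipClass ρ, ENNReal.ofReal (d - c) ≤ Q * φ⁻¹ *
      (ρ (fun x => ‖f x - g x‖ₑ) + φ * recipProfileNorm μ ρ s * ρ (gradModulus g)) := by
    intro g hg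
    obtain ⟨L, hL⟩ := hg.1
    have hgm : Measurable g := hL.continuous.measurable
    have hum : Measurable fun x => ‖f x - g x‖ₑ := (hf.sub hgm).enorm
    set r := ρ (fun x => ‖f x - g x‖ₑ) with hr
    rcases eq_or_ne r ∞ with hrt | hrt
    · rw [hrt, top_add, ENNReal.mul_top (mul_ne_zero hQ0 (ENNReal.inv_ne_zero.2 hφt))]
      exact le_top
    -- Any `l > r / φ'` makes `{|f - g| > l}` have measure at most `s/4`. Shifting both levels
    -- inwards by `l` then moves the masses from `s` to at most `5s/4` and from `s/2` to at least
    -- `s/4`.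
    have hmain : ∀ l : ℝ≥0, r < l * φ' → ENNReal.ofReal (d - c) ≤
        8 * (C : ℝ≥0∞)⁻¹ * (recipProfileNorm μ ρ s * ρ (gradModulus g)) + 2 * l := by
      intro l hl
      have hbad : μ {x | (l : ℝ≥0∞) < ‖f x - g x‖ₑ} ≤ ENNReal.ofReal (s / 4) := by
        by_contra hcon
        exact absurd (mul_fundamentalFunction_le hρ hstd.separable hum (not_le.1 hcon).le)
          (not_le.2 hl)
      have hgood : ∀ x, ¬ (l : ℝ≥0∞) < ‖f x - g x‖ₑ → |f x - g x| ≤ l := by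
        intro x hx
        rw [not_lt, Real.enorm_eq_ofReal_abs, ENNReal.ofReal_le_iff_le_toReal ENNReal.coe_ne_top]
          at hx
        exact hx
      have ha : μ ({x | c + l < g x} ∩ G) ≤ ENNReal.ofReal (5 / 4 * s) := by
        calc μ ({x | c + l < g x} ∩ G)
            ≤ μ (({x | c < f x} ∩ G) ∪ {x | (l : ℝ≥0∞) < ‖f x - g x‖ₑ}) := by
              refine measure_mono fun x hx => ?_
              by_cases hxb : (l : ℝ≥0∞) < ‖f x - g x‖ₑ
              · exact Or.inr hxb
              · have h1 := abs_le.1 (hgood x hxb)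
                have h2 : c + l < g x := hx.1
                exact Or.inl ⟨show c < f x by linarith, hx.2⟩
          _ ≤ ENNReal.ofReal s + ENNReal.ofReal (s / 4) :=
              (measure_union_le _ _).trans (add_le_add hc hbad)
          _ = _ := by
              rw [← ENNReal.ofReal_add hs.le (by linarith)]
              congr 1
              ring
      have hb : ENNReal.ofReal (s / 4) ≤ μ ({x | d - l ≤ g x} ∩ G) := by
        have h3 : ENNReal.ofReal (s / 4) + ENNReal.ofReal (s / 4) ≤
            μ ({x | d - l ≤ g x} ∩ G) + ENNReal.ofReal (s / 4) := by
          calc ENNReal.ofReal (s / 4) + ENNReal.ofReal (s / 4) = ENNReal.ofReal (s / 2) := by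
                rw [← ENNReal.ofReal_add (by linarith) (by linarith)]
                congr 1
                ring
            _ ≤ μ ({x | d ≤ f x} ∩ G) := hd
            _ ≤ μ (({x | d - l ≤ g x} ∩ G) ∪ {x | (l : ℝ≥0∞) < ‖f x - g x‖ₑ}) := by
                refine measure_mono fun x hx => ?_
                by_cases hxb : (l : ℝ≥0∞) < ‖f x - g x‖ₑ
                · exact Or.inr hxb
                · have h1 := abs_le.1 (hgood x hxb)
                  have h2 : d ≤ f x := hx.1
                  exact Or.inl ⟨show d - l ≤ g x by linarith, hx.2⟩
            _ ≤ _ := (measure_union_le _ _).trans (add_le_add le_rfl hbad)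
        exact (ENNReal.add_le_add_iff_right ENNReal.ofReal_ne_top).1 h3
      have h4 := levels_gap_le hstd hpos hρ hG hα hC hrel hs hsα hg ha hb
      calc ENNReal.ofReal (d - c) = ENNReal.ofReal ((d - l - (c + l)) + 2 * l) := by
            congr 1
            ring
        _ ≤ ENNReal.ofReal (d - l - (c + l)) + ENNReal.ofReal (2 * l) := ENNReal.ofReal_add_le
        _ ≤ _ := by
            refine add_le_add h4 (le_of_eq ?_)
            rw [ENNReal.ofReal_mul (by norm_num), ENNReal.ofReal_coe_nnreal, ENNReal.ofReal_ofNat]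
    -- Let `l` decrease to `r / φ'`.
    have hlim : ENNReal.ofReal (d - c) ≤
        8 * (C : ℝ≥0∞)⁻¹ * (recipProfileNorm μ ρ s * ρ (gradModulus g)) + 2 * (r / φ') := by
      refine ENNReal.le_of_forall_pos_le_add fun ε hε _ => ?_
      have hrφ : r / φ' ≠ ∞ := ENNReal.div_ne_top hrt hφ0'
      have h1 : r / φ' < ((r / φ').toNNReal + ε / 2 : ℝ≥0) := by
        rw [ENNReal.coe_add, ENNReal.coe_toNNReal hrφ]
        exact ENNReal.lt_add_right hrφ (by simpa using hε.ne')
      refine (hmain _ ((ENNReal.div_lt_iff (Or.inl hφ0') (Or.inl hφt')).1 h1)).trans_eq ?_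
      rw [ENNReal.coe_add, ENNReal.coe_toNNReal hrφ, mul_add, ← add_assoc]
      congr 1
      rw [← ENNReal.coe_ofNat, ← ENNReal.coe_mul, mul_div_cancel₀ _ two_ne_zero]
    refine hlim.trans ?_
    have h5 : r / φ' ≤ 4 * (φ⁻¹ * r) := by
      rw [ENNReal.div_le_iff hφ0' hφt']
      calc r = φ * (φ⁻¹ * r) := by rw [← mul_assoc, ENNReal.mul_inv_cancel hφ0 hφt, one_mul]
        _ ≤ 4 * φ' * (φ⁻¹ * r) := by gcongr
        _ = _ := by ring
    calc 8 * (C : ℝ≥0∞)⁻¹ * (recipProfileNorm μ ρ s * ρ (gradModulus g)) + 2 * (r / φ')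
        ≤ 8 * (C : ℝ≥0∞)⁻¹ * (recipProfileNorm μ ρ s * ρ (gradModulus g)) +
          2 * (4 * (φ⁻¹ * r)) := by gcongr
      _ = 8 * (C : ℝ≥0∞)⁻¹ * (φ⁻¹ * φ * (recipProfileNorm μ ρ s * ρ (gradModulus g))) +
          8 * 1 * (φ⁻¹ * r) := by
          rw [ENNReal.inv_mul_cancel hφ0 hφt, one_mul]
          ring
      _ ≤ Q * (φ⁻¹ * φ * (recipProfileNorm μ ρ s * ρ (gradModulus g))) + Q * (φ⁻¹ * r) := by
          rw [hQ]
          gcongr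
          · exact le_add_self
          · exact le_self_add
      _ = _ := by ring
  have h0 : Q * φ⁻¹ ≠ 0 := mul_ne_zero hQ0 (ENNReal.inv_ne_zero.2 hφt)
  have ht : Q * φ⁻¹ ≠ ∞ := ENNReal.mul_ne_top hQt (ENNReal.inv_ne_top.2 hφ0)
  rw [kRate, ENNReal.div_eq_inv_mul, ← mul_assoc, ← ENNReal.inv_mul_le_iff h0 ht]
  exact le_iInf₂ fun g hg => (ENNReal.inv_mul_le_iff h0 ht).2 (key g hg)

end SingleScale

/-! ### Invariance and monotonicity of the K-functional; passage to an integral. -/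

section KRate

variable {Ω : Type*} [MetricSpace Ω]

theorem gradModulus_neg (g : Ω → ℝ) : gradModulus (fun x => -g x) = gradModulus g := by
  ext x
  simp only [gradModulus, edist_neg_neg]

theorem neg_mem_lipClass {ρ : (Ω → ℝ≥0∞) → ℝ≥0∞} {g : Ω → ℝ} (hg : g ∈ lipClass ρ) :
    (fun x => -g x) ∈ lipClass ρ := by
  obtain ⟨⟨L, hL⟩, h⟩ := hg
  exact ⟨⟨L, hL.neg⟩, by rwa [gradModulus_neg]⟩

theorem kFunctional_neg (ρ : (Ω → ℝ≥0∞) → ℝ≥0∞) (t : ℝ≥0∞) (f : Ω → ℝ) :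
    kFunctional ρ t (fun x => -f x) = kFunctional ρ t f := by
  have key : ∀ f : Ω → ℝ, kFunctional ρ t (fun x => -f x) ≤ kFunctional ρ t f := by
    intro f
    refine le_iInf₂ fun g hg => iInf₂_le_of_le _ (neg_mem_lipClass hg) (le_of_eq ?_)
    rw [gradModulus_neg]
    congr 2
    ext x
    rw [← enorm_neg]
    congr 1
    ring
  refine le_antisymm (key f) ?_
  simpa using key fun x => -f x

theorem kFunctional_mono (ρ : (Ω → ℝ≥0∞) → ℝ≥0∞) (f : Ω → ℝ) {t t' : ℝ≥0∞} (h : t ≤ t') :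
    kFunctional ρ t f ≤ kFunctional ρ t' f := by
  unfold kFunctional
  gcongr

variable [MeasurableSpace Ω]

theorem recipProfileNorm_mono (μ : Measure Ω) (ρ : (Ω → ℝ≥0∞) → ℝ≥0∞) {t t' : ℝ} (h : t ≤ t') :
    recipProfileNorm μ ρ t ≤ recipProfileNorm μ ρ t' := by
  unfold recipProfileNorm associateNorm
  refine iSup_mono fun k => iSup_mono fun _ => iSup_mono fun _ => lintegral_mono fun s => ?_
  exact mul_le_mul_right
    (indicator_le_indicator_of_subset (Ioo_subset_Ioo_right h) (fun _ => zero_le) s) _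

variable [BorelSpace Ω] {μ : Measure Ω} {ρ : (Ω → ℝ≥0∞) → ℝ≥0∞}

theorem kFunctional_congr (hρ : IsRINorm μ ρ) {f f' : Ω → ℝ} (hf : AEMeasurable f μ)
    (h : f =ᵐ[μ] f') (t : ℝ≥0∞) : kFunctional ρ t f = kFunctional ρ t f' := by
  unfold kFunctional
  refine iInf_congr fun g => iInf_congr fun hg => ?_
  obtain ⟨L, hL⟩ := hg.1
  have hg' : AEMeasurable g μ := hL.continuous.measurable.aemeasurable
  congr 1
  refine hρ.congr (hf.sub hg').enorm ((hf.congr h).sub hg').enorm ?_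
  filter_upwards [h] with x hx
  rw [hx]

variable [IsFiniteMeasure μ] [NullSingletonClass μ]

/-- On `(t, 2t)` the numerator of `kRate` does not decrease and its denominator at most doubles, so
`kRate t ≤ 2 kRate s`. With `1/s ≥ 1/(2t)` on an interval of length `t`, the constant is 4. -/
theorem kRate_le_lintegral (hρ : IsRINorm μ ρ)
    (hsep : ∃ S : Set Ω, TopologicalSpace.IsSeparable S ∧ μ Sᶜ = 0) (f : Ω → ℝ) {t : ℝ}
    (ht : 0 < t) (htM : 2 * t ≤ (μ univ).toReal) :
    kRate μ ρ f t ≤ 4 * ∫⁻ s in Ioo t (2 * t), kRate μ ρ f s / ENNReal.ofReal s := by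
  have hrate : ∀ s ∈ Ioo t (2 * t), kRate μ ρ f t ≤ 2 * kRate μ ρ f s := by
    intro s hs
    have h1 : fundamentalFunction μ ρ s ≤ 2 * fundamentalFunction μ ρ t :=
      (fundamentalFunction_mono hρ hsep hs.2.le).trans
        (fundamentalFunction_two_mul_le hρ hsep ht.le htM)
    have h2 : (fundamentalFunction μ ρ t)⁻¹ ≤ 2 * (fundamentalFunction μ ρ s)⁻¹ := by
      rw [← ENNReal.inv_le_inv, ENNReal.mul_inv (Or.inl (by simp)) (Or.inl (by simp))]
      simp only [inv_inv]
      rwa [ENNReal.inv_mul_le_iff (by simp) (by simp)]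
    rw [kRate, kRate, div_eq_mul_inv, div_eq_mul_inv, mul_left_comm]
    refine mul_le_mul' (kFunctional_mono ρ f ?_) h2
    exact mul_le_mul' (fundamentalFunction_mono hρ hsep hs.1.le)
      (recipProfileNorm_mono μ ρ hs.1.le)
  have h2t : ENNReal.ofReal t ≠ 0 := by simpa using ht
  calc kRate μ ρ f t
      = 4 * (kRate μ ρ f t / 2 / ENNReal.ofReal (2 * t) * ENNReal.ofReal t) := by
        rw [ENNReal.ofReal_mul (by norm_num), ENNReal.ofReal_ofNat]
        simp only [div_eq_mul_inv]
        rw [ENNReal.mul_inv (Or.inl (by simp)) (Or.inl (by simp))]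
        calc kRate μ ρ f t = kRate μ ρ f t * ((2 * 2⁻¹) * (2 * 2⁻¹)) *
              ((ENNReal.ofReal t)⁻¹ * ENNReal.ofReal t) := by
              rw [ENNReal.mul_inv_cancel (by simp) (by simp),
                ENNReal.inv_mul_cancel h2t ENNReal.ofReal_ne_top, one_mul, mul_one, mul_one]
          _ = _ := by ring
    _ = 4 * ∫⁻ _ in Ioo t (2 * t), kRate μ ρ f t / 2 / ENNReal.ofReal (2 * t) := by
        rw [setLIntegral_const, Real.volume_Ioo, two_mul, add_sub_cancel_right]
    _ ≤ _ := by
        refine mul_le_mul_right (setLIntegral_mono' measurableSet_Ioo fun s hs => ?_) _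
        refine ENNReal.div_le_div ?_ (ENNReal.ofReal_le_ofReal hs.2.le)
        rw [ENNReal.div_le_iff' (by simp) (by simp)]
        exact hrate s hs

end KRate

/-! ### Summation over dyadic quantiles. -/

section Oscillation

variable {Ω : Type*} [MetricSpace Ω] [MeasurableSpace Ω] [BorelSpace Ω] {μ : Measure Ω}
  [IsFiniteMeasure μ] [NullSingletonClass μ] {ρ : (Ω → ℝ≥0∞) → ℝ≥0∞}

/-- Upper bound for `f` on `G` in terms of a median and the K-functional. -/
theorem ae_le_median_add (hstd : StandardAssumptions μ)
    (hpos : ∀ t ∈ Ioo 0 (μ univ).toReal, profile μ t ≠ 0) (hρ : IsRINorm μ ρ)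
    {G : Set Ω} (hG : MeasurableSet G) {α : ℝ} (hα0 : 0 < α) (hα : μ G = ENNReal.ofReal α)
    {C : ℝ≥0} (hC : C ≠ 0) (hrel : ∀ s ∈ Ioo 0 α,
      C * min (profile μ s) (profile μ (α - s)) ≤ relProfile μ G s)
    {f : Ω → ℝ} (hf : Measurable f)
    (hK : ∫⁻ t in Ioo 0 α, kRate μ ρ f t / ENNReal.ofReal t ≠ ∞) {c : ℝ}
    (hc : μ ({x | c < f x} ∩ G) ≤ ENNReal.ofReal (α / 2)) :
    ∀ᵐ x ∂μ, x ∈ G → f x ≤ c + (8 * (1 + (C : ℝ≥0∞)⁻¹) * 4 *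
      ∫⁻ t in Ioo 0 α, kRate μ ρ f t / ENNReal.ofReal t).toReal := by
  have hαM : α ≤ (μ univ).toReal := by
    have h1 : μ G ≤ μ univ := measure_mono (subset_univ _)
    rw [hα] at h1
    exact (ENNReal.ofReal_le_iff_le_toReal (measure_ne_top _ _)).1 h1
  set Q : ℝ≥0∞ := 8 * (1 + (C : ℝ≥0∞)⁻¹) with hQ
  have hQt : Q ≠ ∞ := ENNReal.mul_ne_top (by simp) (by simp [hC])
  set J : Set ℝ → ℝ≥0∞ := fun A => ∫⁻ t in A, kRate μ ρ f t / ENNReal.ofReal t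
  set s : ℕ → ℝ := fun k => α / 2 / 2 ^ k with hsdef
  have hs0 : ∀ k, 0 < s k := fun k => by positivity
  have hs1 : ∀ k, 2 * s (k + 1) = s k := fun k => by
    simp only [hsdef, pow_succ]
    field_simp
  have hs2 : ∀ k, 2 * s k ≤ α := fun k => by
    have : (1 : ℝ) ≤ 2 ^ k := one_le_pow₀ (by norm_num)
    have h1 : α / 2 / 2 ^ k ≤ α / 2 := div_le_self (by linarith) this
    simp only [hsdef]
    linarith
  have hquant : ∀ k, ∃ q : ℝ, μ ({x | q < f x} ∩ G) ≤ ENNReal.ofReal (s (k + 1)) ∧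
      ENNReal.ofReal (s (k + 1)) ≤ μ ({x | q ≤ f x} ∩ G) := by
    intro k
    obtain ⟨q, h1, h2⟩ := exists_quantile (μ.restrict G) hf (s := ENNReal.ofReal (s (k + 1)))
      (by simpa using hs0 (k + 1)) (by
        rw [Measure.restrict_apply_univ, hα]
        exact (ENNReal.ofReal_lt_ofReal_iff hα0).2 (by linarith [hs2 (k + 1), hs0 (k + 1)]))
    rw [Measure.restrict_apply' hG] at h1 h2
    exact ⟨q, h1, h2⟩
  choose q' hq1 hq2 using hquant
  -- The sequence starts at the given level `c`, with mass `s 0 = α/2`; later terms are quantiles at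
  -- mass `s k`.
  set q : ℕ → ℝ := fun k => Nat.casesOn k c q' with hqdef
  have hqle : ∀ k, μ ({x | q k < f x} ∩ G) ≤ ENNReal.ofReal (s k) := by
    rintro (_ | k)
    · rw [show s 0 = α / 2 by simp [hsdef]]
      exact hc
    · exact hq1 k
  have hgap : ∀ k, ENNReal.ofReal (q (k + 1) - q k) ≤ Q * 4 * J (Ioo (s k) (2 * s k)) := by
    intro k
    have h1 := quantile_gap_le hstd hpos hρ hG hα hC hrel hf (hs0 k) (hs2 k) (hqle k)
      (d := q (k + 1)) (by
        rw [show s k / 2 = s (k + 1) by linarith [hs1 k]]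
        exact hq2 k)
    rw [mul_assoc]
    exact h1.trans (mul_le_mul_right
      (kRate_le_lintegral hρ hstd.separable f (hs0 k) ((hs2 k).trans hαM)) _)
  -- The gaps telescope, and since `2 s (n+1) = s n` the next interval `(s n, 2 s n)` adjoins the
  -- part already covered.
  have hsum : ∀ n, ENNReal.ofReal (q n - c) ≤ Q * 4 * J (Ioo (2 * s n) α) := by
    intro n
    induction n with
    | zero => simp [hqdef]
    | succ n ih =>
      have hdisj : Disjoint (Ioo (s n) (2 * s n)) (Ioo (2 * s n) α) :=
        disjoint_left.2 fun x h1 h2 => absurd (h1.2.trans h2.1) (lt_irrefl _)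
      calc ENNReal.ofReal (q (n + 1) - c)
          = ENNReal.ofReal ((q (n + 1) - q n) + (q n - c)) := by
            congr 1
            ring
        _ ≤ ENNReal.ofReal (q (n + 1) - q n) + ENNReal.ofReal (q n - c) := ENNReal.ofReal_add_le
        _ ≤ Q * 4 * J (Ioo (s n) (2 * s n)) + Q * 4 * J (Ioo (2 * s n) α) :=
            add_le_add (hgap n) ih
        _ = Q * 4 * J (Ioo (s n) (2 * s n) ∪ Ioo (2 * s n) α) := by
            rw [← mul_add]
            exact congrArg _ (lintegral_union measurableSet_Ioo hdisj).symm
        _ ≤ Q * 4 * J (Ioo (2 * s (n + 1)) α) := by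
            refine mul_le_mul_right (lintegral_mono_set ?_) _
            rw [hs1]
            exact union_subset (Ioo_subset_Ioo_right (hs2 n))
              (Ioo_subset_Ioo_left (by linarith [hs0 n]))
  set B := (Q * 4 * J (Ioo 0 α)).toReal with hB
  have hBt : Q * 4 * J (Ioo 0 α) ≠ ∞ := ENNReal.mul_ne_top (ENNReal.mul_ne_top hQt (by simp)) hK
  have hqB : ∀ n, q n ≤ c + B := by
    intro n
    have h1 : ENNReal.ofReal (q n - c) ≤ Q * 4 * J (Ioo 0 α) :=
      (hsum n).trans (mul_le_mul_right
        (lintegral_mono_set (Ioo_subset_Ioo_left (by linarith [hs0 n]))) _)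
    have h2 := (ENNReal.ofReal_le_iff_le_toReal hBt).1 h1
    linarith
  have hlim : Tendsto (fun n => ENNReal.ofReal (s n)) atTop (𝓝 0) := by
    have h1 : Tendsto s atTop (𝓝 0) :=
      tendsto_const_nhds.div_atTop (tendsto_pow_atTop_atTop_of_one_lt one_lt_two)
    simpa using ENNReal.tendsto_ofReal h1
  -- All `q n` stay below `c + B`, so this set has measure at most `s n` for every `n`.
  have hnull : μ ({x | c + B < f x} ∩ G) = 0 := by
    refine le_antisymm (ge_of_tendsto' hlim fun n => (measure_mono ?_).trans (hqle n)) zero_le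
    exact inter_subset_inter_left _ fun x hx => (hqB n).trans_lt hx
  refine ae_iff.2 (measure_mono_null (fun x hx => ?_) hnull)
  simp only [mem_ofPred_eq, Classical.not_imp, not_le] at hx
  exact ⟨hx.2, hx.1⟩

/-- The essential oscillation of `f` on `G` is controlled by the K-functional. -/
theorem exists_ae_abs_sub_le (hstd : StandardAssumptions μ)
    (hpos : ∀ t ∈ Ioo 0 (μ univ).toReal, profile μ t ≠ 0) (hρ : IsRINorm μ ρ)
    {G : Set Ω} (hG : MeasurableSet G) {α : ℝ} (hα0 : 0 < α) (hα : μ G = ENNReal.ofReal α)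
    {C : ℝ≥0} (hC : C ≠ 0) (hrel : ∀ s ∈ Ioo 0 α,
      C * min (profile μ s) (profile μ (α - s)) ≤ relProfile μ G s)
    {f : Ω → ℝ} (hf : Measurable f)
    (hK : ∫⁻ t in Ioo 0 α, kRate μ ρ f t / ENNReal.ofReal t ≠ ∞) :
    ∃ c : ℝ, ∀ᵐ x ∂μ, x ∈ G → |f x - c| ≤ (8 * (1 + (C : ℝ≥0∞)⁻¹) * 4 *
      ∫⁻ t in Ioo 0 α, kRate μ ρ f t / ENNReal.ofReal t).toReal := by
  obtain ⟨c, h1, h2⟩ := exists_quantile (μ.restrict G) hf (s := ENNReal.ofReal (α / 2))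
    (by simpa using hα0) (by
      rw [Measure.restrict_apply_univ, hα]
      exact (ENNReal.ofReal_lt_ofReal_iff hα0).2 (by linarith))
  -- The second quantile inequality says that `-c` is an admissible starting level for `-f`.
  have h3 : μ ({x | -c < -f x} ∩ G) ≤ ENNReal.ofReal (α / 2) := by
    have h4 : {x | -c < -f x} = {x | c ≤ f x}ᶜ := by
      ext x
      simp
    rw [← Measure.restrict_apply' hG, h4,
      measure_compl (measurableSet_le measurable_const hf) (measure_ne_top _ _),
      Measure.restrict_apply_univ, hα]
    refine (tsub_le_tsub_left h2 _).trans ?_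
    rw [← ENNReal.ofReal_sub _ (by linarith)]
    exact ENNReal.ofReal_le_ofReal (by linarith)
  rw [Measure.restrict_apply' hG] at h1
  have hneg : kRate μ ρ (fun x => -f x) = kRate μ ρ f := by
    ext t
    rw [kRate, kRate, kFunctional_neg]
  have hup := ae_le_median_add hstd hpos hρ hG hα0 hα hC hrel hf hK h1
  have hlow := ae_le_median_add hstd hpos hρ hG hα0 hα hC hrel (f := fun x => -f x) hf.neg
    (by rwa [hneg]) h3
  rw [hneg] at hlow
  refine ⟨c, ?_⟩
  filter_upwards [hup, hlow] with x hx1 hx2 hxG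
  have h5 := hx1 hxG
  have h6 := hx2 hxG
  rw [abs_le]
  constructor <;> linarith

end Oscillation

end MetricMorrey

/-! ### Boundedness and continuity. -/

theorem mainTheorem7 {Ω : Type*} [MetricSpace Ω] [ConnectedSpace Ω] [MeasurableSpace Ω]
    [BorelSpace Ω] (μ : Measure Ω) [IsFiniteMeasure μ] [NullSingletonClass μ]
    (hstd : StandardAssumptions μ) (hrel : UniformRelativeIsoperimetric μ)
    (ρ : (Ω → ℝ≥0∞) → ℝ≥0∞) (hρ : IsRINorm μ ρ)
    (hI : associateNorm (intervalMeasure μ) (representationNorm μ ρ)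
      (fun s => (profile μ s)⁻¹) < ∞)
    (f : Ω → ℝ) (hf : MemSum μ ρ f)
    (hK : ∫⁻ t in Ioo 0 (μ univ).toReal,
      kFunctional ρ (fundamentalFunction μ ρ t * recipProfileNorm μ ρ t) f
        / fundamentalFunction μ ρ t / ENNReal.ofReal t < ∞) :
    (∃ M : ℝ, ∀ᵐ x ∂μ, |f x| ≤ M) ∧ (∃ g : Ω → ℝ, Continuous g ∧ f =ᵐ[μ] g) := by
  have hfm : AEMeasurable f μ := by
    obtain ⟨u, g, hu, -, ⟨⟨L, hL⟩, -⟩, hfe⟩ := hf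
    exact (hu.add hL.continuous.measurable.aemeasurable).congr hfe.symm
  obtain ⟨f', hf', hff'⟩ := hfm
  have hK' : ∫⁻ t in Ioo 0 (μ univ).toReal, kRate μ ρ f' t / ENNReal.ofReal t ≠ ∞ := by
    simp only [kRate, ← kFunctional_congr hρ ⟨f', hf', hff'⟩ hff']
    exact hK.ne
  have hpos : ∀ t ∈ Ioo 0 (μ univ).toReal, profile μ t ≠ 0 :=
    fun t ht => profile_ne_zero hstd hρ hI ht
  suffices h : (∃ M : ℝ, ∀ᵐ x ∂μ, |f' x| ≤ M) ∧ ∃ g : Ω → ℝ, Continuous g ∧ f' =ᵐ[μ] g by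
    obtain ⟨⟨M, hM⟩, g, hg, hfg⟩ := h
    refine ⟨⟨M, ?_⟩, g, hg, hff'.trans hfg⟩
    filter_upwards [hM, hff'] with x hx hx'
    rwa [hx']
  constructor
  · rcases ENNReal.toReal_nonneg.eq_or_lt (a := 0) (b := (μ univ).toReal) with h0 | h0
    · have : μ = 0 := by
        rw [← Measure.measure_univ_eq_zero]
        exact ((ENNReal.toReal_eq_zero_iff _).1 h0.symm).resolve_right (measure_ne_top _ _)
      exact ⟨0, by simp [this]⟩
    -- On the whole space the relative isoperimetric inequality holds with constant 1: by symmetry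
    -- both terms of the minimum equal `I(s)`.
    · obtain ⟨c, hc⟩ := exists_ae_abs_sub_le hstd hpos hρ MeasurableSet.univ h0
        (ENNReal.ofReal_toReal (measure_ne_top _ _)).symm one_ne_zero (fun s hs => by
          rw [hstd.profile_symm s ⟨hs.1.le, hs.2.le⟩, min_self, ENNReal.coe_one, one_mul]
          exact le_rfl) hf' hK'
      refine ⟨_, hc.mono fun x hx => (abs_sub_le (f' x) c 0 |>.trans' (by simp)).trans
        (add_le_add (hx (mem_univ x)) le_rfl)⟩
  · refine exists_continuous_ae_eq μ hstd.separable f' fun x ε hε => ?_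
    obtain ⟨C, hC, δ, hδ, hball⟩ := hrel
    set Q : ℝ≥0∞ := 8 * (1 + (C : ℝ≥0∞)⁻¹) * 4 with hQ
    have hQ0 : Q ≠ 0 := by simp [hQ]
    have hQt : Q ≠ ∞ := ENNReal.mul_ne_top (ENNReal.mul_ne_top (by simp) (by simp [hC.ne']))
      (by simp)
    -- Absolute continuity of the integral: `∫_0^α` falls below `ε / Q` once `α`, the measure of the
    -- ball, is small.
    obtain ⟨η, hη, hηK⟩ := exists_pos_setLIntegral_lt_of_measure_lt hK'
      (ε := ENNReal.ofReal ε / Q) (ENNReal.div_ne_zero.2 ⟨by simpa using hε, hQt⟩)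
    have hlim : Tendsto (fun n : ℕ => μ (Metric.ball x (1 / ((n : ℝ) + 1)))) atTop (𝓝 0) := by
      have h1 := tendsto_measure_iInter_atTop (μ := μ)
        (s := fun n : ℕ => Metric.ball x (1 / ((n : ℝ) + 1)))
        (fun n => Metric.isOpen_ball.measurableSet.nullMeasurableSet)
        (fun m n hmn => Metric.ball_subset_ball (Nat.one_div_le_one_div hmn))
        ⟨0, measure_ne_top _ _⟩
      have h2 : ⋂ n : ℕ, Metric.ball x (1 / ((n : ℝ) + 1)) = {x} := by
        refine Subset.antisymm (fun y hy => ?_) (fun y hy => ?_)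
        · refine dist_le_zero.1 (le_of_forall_pos_le_add fun κ hκ => ?_)
          obtain ⟨n, hn⟩ := exists_nat_one_div_lt hκ
          have := Metric.mem_ball.1 (mem_iInter.1 hy n)
          linarith
        · rw [mem_singleton_iff.1 hy]
          exact mem_iInter.2 fun n => Metric.mem_ball_self (by positivity)
      rwa [h2, measure_singleton] at h1
    obtain ⟨n, hn1, hn2⟩ := ((hlim.eventually_lt_const hη).and
      (hlim.eventually_lt_const (ENNReal.ofReal_pos.2 hδ))).exists
    set r : ℝ := 1 / ((n : ℝ) + 1) with hr
    refine ⟨r, by positivity, ?_⟩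
    set α := (μ (Metric.ball x r)).toReal with hαdef
    have hα : μ (Metric.ball x r) = ENNReal.ofReal α :=
      (ENNReal.ofReal_toReal (measure_ne_top _ _)).symm
    have hα0 : 0 ≤ α := ENNReal.toReal_nonneg
    -- A null ball needs no estimate, so any `c` works.
    rcases hα0.eq_or_lt with h0 | h0
    · rw [← h0, ENNReal.ofReal_zero] at hα
      refine ⟨0, ?_⟩
      filter_upwards [measure_eq_zero_iff_ae_notMem.1 hα] with y hy hy'
      exact absurd hy' hy
    · have hαδ : α < δ := by
        rw [hα] at hn2
        exact (ENNReal.ofReal_lt_ofReal_iff hδ).1 hn2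
      have hαM : α ≤ (μ univ).toReal :=
        ENNReal.toReal_mono (measure_ne_top _ _) (measure_mono (subset_univ _))
      have hJ : ∫⁻ t in Ioo 0 α, kRate μ ρ f' t / ENNReal.ofReal t < ENNReal.ofReal ε / Q := by
        have h1 := hηK (Ioo 0 α) (by
          rw [Measure.restrict_apply measurableSet_Ioo]
          refine (measure_mono inter_subset_left).trans_lt ?_
          rwa [Real.volume_Ioo, sub_zero, ← hα])
        rwa [Measure.restrict_restrict measurableSet_Ioo,
          inter_eq_left.2 (Ioo_subset_Ioo_right hαM)] at h1
      obtain ⟨c, hc⟩ := exists_ae_abs_sub_le hstd hpos hρ Metric.isOpen_ball.measurableSet h0 hα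
        hC.ne' (hball x r α h0 hαδ hα) hf' hJ.ne_top
      refine ⟨c, hc.mono fun y hy hyb => (hy hyb).trans ?_⟩
      refine ENNReal.toReal_le_of_le_ofReal hε.le ?_
      rw [mul_comm]
      exact (ENNReal.le_div_iff_mul_le (Or.inl hQ0) (Or.inl hQt)).1 hJ.le
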